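/- Let $R$ and $S$ be associative rings with identity and let ${}_RC_S$ be a semidualizing $(R,S)$-bimodule, i.e. ${}_RC$ and $C_S$ admit projective resolutions by finitely generated modules, the homothety maps $R\to\operatorname{Hom}_{S^{op}}(C,C)$ and $S\to\operatorname{Hom}_R(C,C)$ are isomorphisms, and $\operatorname{Ext}^{i}_R(C,C)=0=\operatorname{Ext}^{i}_{S^{op}}(C,C)$ for all $i\ge 1$. It is called faithfully semidualizing if, moreover, for $M\in\operatorname{Mod}R$ and $N\in\operatorname{Mod}S^{op}$, $\operatorname{Hom}_R(C,M)=0$ implies $M=0$, and $\operatorname{Hom}_{S^{op}}(C,N)=0$ implies $N=0$. Here $\operatorname{Mod}R$ denotes the category of left $R$-modules, and $\operatorname{Mod}S^{op}$ that of right $S$-modules. Let $\mathcal F_C(R)$ be the class of $C$-flat modules, that is, of left $R$-modules isomorphic to $C\otimes_SP$ with $P$ a flat left $S$-module; let $\mathcal C_C(R)$ be the class of $C$-cotorsion modules, that is, of left $R$-modules $A$ with $\operatorname{Ext}^i_R(Q,A)=0$ for all $Q\in\mathcal F_C(R)$ and all $i\ge1$; and let $\mathcal{PI}(R)$ be the class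 of pure injective left $R$-modules, that is, of those $E$ for which $\operatorname{Hom}_R(-,E)$ preserves the exactness of pure short exact sequences. (A short exact sequence of left $R$-modules is pure if $\operatorname{Hom}_R(M,-)$ preserves its exactness for every finitely presented $M$.) Assume that $S$ is right coherent. Then the following hold. 1. $\mathcal F_C(R)\cap\mathcal C_C(R)=\mathcal F_C(R)\cap\mathcal{PI}(R)$. 2. $\mathcal F_C(R)\cap\mathcal{PI}(R)$ is an injective cogenerator for $\mathcal F_C(R)$: for every $A\in\mathcal F_C(R)$ there is a short exact sequence $0\to A\to D\to A'\to 0$ with $D\in\mathcal F_C(R)\cap\mathcal{PI}(R)$ and $A'\in\mathcal F_C(R)$; and $\operatorname{Ext}_R^i(Q,D)=0$ for all $Q\in\mathcal F_C(R)$, $D\in\mathcal F_C(R)\cap\mathcal{PI}(R)$ and $i\ge 1$. 3. If $C$ is faithfully semidualizing, then $\mathcal F_C(R)\cap\mathcal{PI}(R)$ is preenveloping in $\operatorname{Mod}R$: for every left $R$-module $A$ there is a homomorphism $f\colon A\to D$ with $D\in\mathcal F_C(R)\cap\mathcal{PI}(R)$ such that every homomorphism from $A$ to a module in $\mathcal F_C(R)\cap\mathcal{PI}(R)$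 factors through $f$. -/

import Mathlib

open CategoryTheory CategoryTheory.Abelian
open scoped TensorProduct

universe u

namespace Semidualizing

/-! ### Tensor products over a noncommutative ring

Right `S`-modules are modules over `Sᵐᵒᵖ`, and an `(R, S)`-bimodule is an abelian group with
commuting actions of `R` and `Sᵐᵒᵖ`. -/

section Tensor

variable (R : Type*) (S : Type*) (C : Type*) (P : Type*) [Ring R] [Ring S]
  [AddCommGroup C] [Module R C] [Module Sᵐᵒᵖ C] [SMulCommClass R Sᵐᵒᵖ C]
  [AddCommGroup P] [Module S P]

/-- The relations `(c s) ⊗ p - c ⊗ (s p)` in `C ⊗ P` (tensor product over `ℤ`); their `R`-span is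
also their additive span, since `r ((c s) ⊗ p - c ⊗ (s p)) = ((r c) s) ⊗ p - (r c) ⊗ (s p)`. -/
def balancedRelations : Submodule R (C ⊗[ℤ] P) :=
  Submodule.span R {x | ∃ (c : C) (s : S) (p : P),
    x = (MulOpposite.op s • c) ⊗ₜ[ℤ] p - c ⊗ₜ[ℤ] (s • p)}

/-- The tensor product `C ⊗_S P` of an `(R, S)`-bimodule `C` and a left `S`-module `P`, as a left
`R`-module. For a mere right `S`-module, take `R = ℤ`. -/
abbrev BalancedTensor : Type _ := (C ⊗[ℤ] P) ⧸ balancedRelations R S C P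

end Tensor

/-- The additive map `f ⊗_S P : N ⊗_S P → N' ⊗_S P` induced by a map `f : N → N'` of right
`S`-modules. -/
def balancedTensorMap {S : Type*} [Ring S] {N N' : Type*} [AddCommGroup N] [Module Sᵐᵒᵖ N]
    [AddCommGroup N'] [Module Sᵐᵒᵖ N'] (f : N →ₗ[Sᵐᵒᵖ] N')
    (P : Type*) [AddCommGroup P] [Module S P] :
    BalancedTensor ℤ S N P →ₗ[ℤ] BalancedTensor ℤ S N' P :=
  Submodule.mapQ _ _ (TensorProduct.map f.toAddMonoidHom.toIntLinearMap LinearMap.id) <| by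
    rw [balancedRelations, Submodule.span_le]
    rintro _ ⟨c, s, p, rfl⟩
    refine Submodule.subset_span ⟨f c, s, p, ?_⟩
    simp

/-- A left `S`-module `P` is flat if `- ⊗_S P` preserves injections of right `S`-modules. -/
def IsFlat (S : Type u) [Ring S] (P : Type u) [AddCommGroup P] [Module S P] : Prop :=
  ∀ (N N' : Type u) [AddCommGroup N] [AddCommGroup N'] [Module Sᵐᵒᵖ N] [Module Sᵐᵒᵖ N']
    (f : N →ₗ[Sᵐᵒᵖ] N'), Function.Injective f → Function.Injective (balancedTensorMap f P)

/-- A ring is right coherent if its finitely generated right ideals are finitely presented right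
modules. -/
def IsRightCoherent (S : Type u) [Ring S] : Prop :=
  ∀ I : Submodule Sᵐᵒᵖ S, I.FG → Module.FinitePresentation Sᵐᵒᵖ I

/-! ### Subcategories of an abelian category -/

section Abelian

variable {A : Type*} [Category.{u} A] [Abelian A]

/-- `𝒳 ⊥ 𝒴`: all `Ext` groups of positive degree from objects of `𝒳` to objects of `𝒴` vanish. -/
def ExtOrthogonal [HasExt.{u} A] (𝒳 𝒴 : ObjectProperty A) : Prop :=
  ∀ X Y : A, 𝒳 X → 𝒴 Y → ∀ i : ℕ, 1 ≤ i → Subsingleton (Ext X Y i)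

/-- `𝒳^⊥`: the objects `Y` with `Ext^i(X, Y) = 0` for all `X` in `𝒳` and all `i ≥ 1`. -/
def rightPerp [HasExt.{u} A] (𝒳 : ObjectProperty A) : ObjectProperty A :=
  fun Y => ∀ X : A, 𝒳 X → ∀ i : ℕ, 1 ≤ i → Subsingleton (Ext X Y i)

/-- `𝒞 ⊆ 𝒳` is a cogenerator for `𝒳`: every `X` in `𝒳` fits into a short exact sequence
`0 → X → C → X' → 0` with `C` in `𝒞` and `X'` in `𝒳`. -/
def IsCogeneratorFor (𝒞 𝒳 : ObjectProperty A) : Prop :=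
  𝒞 ≤ 𝒳 ∧ ∀ X : A, 𝒳 X → ∃ (C X' : A) (f : X ⟶ C) (g : C ⟶ X') (w : f ≫ g = 0),
    (ShortComplex.mk f g w).ShortExact ∧ 𝒞 C ∧ 𝒳 X'

/-- `𝒞` is an injective cogenerator for `𝒳`. -/
def IsInjectiveCogeneratorFor [HasExt.{u} A] (𝒞 𝒳 : ObjectProperty A) : Prop :=
  IsCogeneratorFor 𝒞 𝒳 ∧ ExtOrthogonal 𝒳 𝒞

/-- `f : M ⟶ X` is an `𝒳`-preenvelope of `M`: `X` is in `𝒳` and every morphism from `M` to an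
object of `𝒳` factors through `f`. -/
def IsPreenvelope (𝒳 : ObjectProperty A) {M X : A} (f : M ⟶ X) : Prop :=
  𝒳 X ∧ ∀ (X' : A), 𝒳 X' → ∀ f' : M ⟶ X', ∃ h : X ⟶ X', f ≫ h = f'

/-- `𝒳` is preenveloping in the whole category: every object has an `𝒳`-preenvelope. -/
def IsPreenveloping (𝒳 : ObjectProperty A) : Prop :=
  ∀ M : A, ∃ (X : A) (f : M ⟶ X), IsPreenvelope 𝒳 f

end Abelian

/-! ### Purity -/

section Pure

variable {R : Type u} [Ring R]

/-- A short exact sequence of left `R`-modules is pure if `Hom_R(M, -)` keeps it exact for every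
finitely presented `M`. As `Hom_R(M, -)` is left exact, this says that maps lift. -/
def IsPureShortExact (E : ShortComplex (ModuleCat.{u} R)) : Prop :=
  E.ShortExact ∧ ∀ M : ModuleCat.{u} R, Module.FinitePresentation R M →
    ∀ g : M ⟶ E.X₃, ∃ h : M ⟶ E.X₂, h ≫ E.g = g

variable (R) in
/-- The pure injective modules `I`: `Hom_R(-, I)` keeps pure short exact sequences exact. As
`Hom_R(-, I)` is left exact, this says that maps extend. -/
def pureInjective : ObjectProperty (ModuleCat.{u} R) :=
  fun I => ∀ E : ShortComplex (ModuleCat.{u} R), IsPureShortExact E →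
    ∀ g : E.X₁ ⟶ I, ∃ h : E.X₂ ⟶ I, E.f ≫ h = g

end Pure

/-! ### Semidualizing bimodules -/

/-- A module admits a degreewise finite projective resolution: a projective resolution by
finitely generated modules. -/
def HasFiniteProjectiveResolution (R : Type u) [Ring R] (M : Type u) [AddCommGroup M]
    [Module R M] : Prop :=
  ∃ P : ProjectiveResolution (ModuleCat.of R M), ∀ n : ℕ, Module.Finite R (P.complex.X n)

section

variable (R S C : Type u) [Ring R] [Ring S] [AddCommGroup C] [Module R C] [Module Sᵐᵒᵖ C]
  [SMulCommClass R Sᵐᵒᵖ C]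

/-- The `(R, S)`-bimodule `C` is semidualizing. -/
structure IsSemidualizing : Prop where
  finite_left : HasFiniteProjectiveResolution R C
  finite_right : HasFiniteProjectiveResolution Sᵐᵒᵖ C
  /-- the homothety map `R → Hom_{Sᵒᵖ}(C, C)`, `r ↦ (c ↦ r c)`, is an isomorphism -/
  homothety_left : Function.Bijective
    (fun r : R => (DistribSMul.toLinearMap Sᵐᵒᵖ C r : C →ₗ[Sᵐᵒᵖ] C))
  /-- the homothety map `S → Hom_R(C, C)`, `s ↦ (c ↦ c s)`, is an isomorphism -/
  homothety_right : letI := SMulCommClass.symm R Sᵐᵒᵖ C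
    Function.Bijective
      (fun s : S => (DistribSMul.toLinearMap R C (MulOpposite.op s) : C →ₗ[R] C))
  ext_left : ∀ i : ℕ, 1 ≤ i → Subsingleton (Ext (ModuleCat.of R C) (ModuleCat.of R C) i)
  ext_right : ∀ i : ℕ, 1 ≤ i →
    Subsingleton (Ext (ModuleCat.of Sᵐᵒᵖ C) (ModuleCat.of Sᵐᵒᵖ C) i)

/-- The `(R, S)`-bimodule `C` is faithfully semidualizing. -/
structure IsFaithfullySemidualizing : Prop extends IsSemidualizing R S C where
  faithful_left : ∀ (M : Type u) [AddCommGroup M] [Module R M],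
    Subsingleton (C →ₗ[R] M) → Subsingleton M
  faithful_right : ∀ (N : Type u) [AddCommGroup N] [Module Sᵐᵒᵖ N],
    Subsingleton (C →ₗ[Sᵐᵒᵖ] N) → Subsingleton N

/-- `ℱ_C(R)`, the `C`-flat modules: the left `R`-modules isomorphic to `C ⊗_S P` for a flat left
`S`-module `P`. -/
def cFlat : ObjectProperty (ModuleCat.{u} R) :=
  fun M => ∃ P : ModuleCat.{u} S, IsFlat S P ∧ Nonempty (M ≃ₗ[R] BalancedTensor R S C P)

/-- `𝒞_C(R) = ℱ_C(R)^⊥`, the `C`-cotorsion modules. -/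
def cCotorsion : ObjectProperty (ModuleCat.{u} R) :=
  rightPerp (cFlat R S C)

end

end Semidualizing

/-!
Write `P⁺ = Hom_ℤ(P, ℚ/ℤ)`. A left `S`-module `P` is flat exactly when `P⁺` is injective, and over a
right coherent ring the character module of an injective right module is flat; so `P⁺⁺` is flat
whenever `P` is, and then so is `P⁺⁺ / P`. As `C` is finitely presented over `Sᵐᵒᵖ`,
`C ⊗_S P⁺⁺ ≅ (C ⊗_S P)⁺⁺` is pure injective, and `C ⊗_S P → C ⊗_S P⁺⁺` is a pure monomorphism with
`C`-flat cokernel. This is the cogenerator sequence, and it splits when `C ⊗_S P` is `C`-cotorsion.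

Let `D ≅ C ⊗_S P` be pure injective with `P` flat. For free `Q`, the vanishing of
`Extⁱ_R(C ⊗_S Q, D)` reduces to that of `Extⁱ_R(C, C ⊗_S P)`, which follows by dimension shifting
along a resolution of `C`, because a map from a finitely presented module to `C ⊗_S P` is a finite
sum of maps through `C`. For flat `Q`, a free presentation stays pure after tensoring with `C`, so
pure injectivity of `D` and dimension shifting apply again.

For the preenvelope, every map `A → C ⊗_S P` with `P` flat factors through `C ⊗_S P₀` for some flat
`P₀` from a set that does not depend on `P`. The product of these `P₀`, over all maps
`A → C ⊗_S P₀`, is flat by coherence, and `C ⊗_S -` commutes with it; its double dual gives the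
preenvelope.
-/

namespace Semidualizing

/-! ### Character modules -/

section Characters

lemma exists_character_comp_eq {A B : Type*} [AddCommGroup A] [AddCommGroup B] (f : A →+ B)
    (χ : CharacterModule A) (h : f.ker ≤ AddMonoidHom.ker χ) :
    ∃ ψ : CharacterModule B, ∀ a, ψ (f a) = χ a := by
  obtain ⟨ψ, hψ⟩ := CharacterModule.dual_surjective_of_injective
    (QuotientAddGroup.kerLift f).toIntLinearMap (QuotientAddGroup.kerLift_injective f)
    (QuotientAddGroup.lift f.ker χ h)
  exact ⟨ψ, fun a => DFunLike.congr_fun hψ (a : A ⧸ f.ker)⟩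

lemma mem_of_forall_character {A : Type*} [AddCommGroup A] {K : AddSubgroup A} {a : A}
    (h : ∀ χ : A →+ AddCircle (1 : ℚ), K ≤ χ.ker → χ a = 0) : a ∈ K := by
  rw [← QuotientAddGroup.eq_zero_iff]
  exact CharacterModule.eq_zero_of_character_apply fun χ =>
    h (AddMonoidHom.comp χ (QuotientAddGroup.mk' K)) fun k hk =>
      (congrArg χ ((QuotientAddGroup.eq_zero_iff k).2 hk)).trans (map_zero χ)

section Apply

variable {A : Type*} [AddCommGroup A]

@[simp] lemma character_add_apply (χ ψ : CharacterModule A) (a : A) : (χ + ψ) a = χ a + ψ a := rfl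

@[simp] lemma character_zero_apply (a : A) : (0 : CharacterModule A) a = 0 := rfl

lemma character_sum_apply {ι : Type*} (s : Finset ι) (χ : ι → CharacterModule A) (a : A) :
    (∑ i ∈ s, χ i) a = ∑ i ∈ s, χ i a :=
  map_sum (AddMonoidHom.eval a : (A →+ AddCircle (1 : ℚ)) →+ _) χ s

end Apply

variable {S N P P' : Type*} [Ring S] [AddCommGroup N] [Module Sᵐᵒᵖ N]
  [AddCommGroup P] [Module S P] [AddCommGroup P'] [Module S P']

noncomputable instance : Module Sᵐᵒᵖ (CharacterModule P) :=
  inferInstanceAs (Module Sᵈᵐᵃ (P →+ AddCircle (1 : ℚ)))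

noncomputable instance : Module S (CharacterModule N) :=
  Module.compHom _ (RingEquiv.opOp S).toRingHom

/-- The map `ψ ↦ ψ ∘ g` from the character module of `P'` to that of `P`, for `g : P → P'`. -/
noncomputable def characterMap (g : P →ₗ[S] P') :
    CharacterModule P' →ₗ[Sᵐᵒᵖ] CharacterModule P where
  toFun ψ := AddMonoidHom.comp ψ g.toAddMonoidHom
  map_add' _ _ := rfl
  map_smul' a ψ := CharacterModule.ext _ fun p => congrArg ψ (map_smul g a.unop p).symm

@[simp] lemma characterMap_apply (g : P →ₗ[S] P') (ψ : CharacterModule P') (p : P) :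
    characterMap g ψ p = ψ (g p) := rfl

lemma characterMap_injective {g : P →ₗ[S] P'} (hg : Function.Surjective g) :
    Function.Injective (characterMap g) :=
  CharacterModule.dual_injective_of_surjective g.toAddMonoidHom.toIntLinearMap hg

lemma characterMap_surjective {g : P →ₗ[S] P'} (hg : Function.Injective g) :
    Function.Surjective (characterMap g) :=
  CharacterModule.dual_surjective_of_injective g.toAddMonoidHom.toIntLinearMap hg

lemma characterMap_exact {Q : Type*} [AddCommGroup Q] [Module S Q] {i : P →ₗ[S] P'}
    {g : P' →ₗ[S] Q} (hex : Function.Exact i g) :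
    Function.Exact (characterMap g) (characterMap i) := by
  refine fun φ => ⟨fun hφ => ?_, ?_⟩
  · obtain ⟨ψ, hψ⟩ := exists_character_comp_eq g.toAddMonoidHom φ fun f hf => by
      obtain ⟨k, rfl⟩ := (hex f).1 hf
      exact DFunLike.congr_fun hφ k
    exact ⟨ψ, CharacterModule.ext _ hψ⟩
  · rintro ⟨ψ, rfl⟩
    exact CharacterModule.ext _ fun p => by simp [hex.apply_apply_eq_zero]

variable (S P) in
/-- The evaluation map from a left module to its double character module. -/
noncomputable def doubleDualEval : P →ₗ[S] CharacterModule (CharacterModule P) where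
  toFun p := (AddMonoidHom.eval p : (P →+ AddCircle (1 : ℚ)) →+ _)
  map_add' p q := CharacterModule.ext _ fun χ => map_add χ p q
  map_smul' _ _ := rfl

lemma doubleDualEval_injective : Function.Injective (doubleDualEval S P) := by
  rw [injective_iff_map_eq_zero]
  exact fun p hp => CharacterModule.eq_zero_of_character_apply fun χ => DFunLike.congr_fun hp χ

variable (S N) in
/-- The evaluation map from a right module to its double character module. -/
noncomputable def doubleDualEvalOp : N →ₗ[Sᵐᵒᵖ] CharacterModule (CharacterModule N) where
  toFun n := (AddMonoidHom.eval n : (N →+ AddCircle (1 : ℚ)) →+ _)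
  map_add' n n' := CharacterModule.ext _ fun χ => map_add χ n n'
  map_smul' _ _ := rfl

lemma characterMap_doubleDualEval_comp_doubleDualEvalOp :
    characterMap (doubleDualEval S P) ∘ₗ doubleDualEvalOp S (CharacterModule P) = LinearMap.id :=
  rfl

end Characters

/-! ### Balanced tensor products -/

namespace BalancedTensor

section Basic

variable (R S : Type*) {C P X : Type*} [Ring R] [Ring S]
  [AddCommGroup C] [Module R C] [Module Sᵐᵒᵖ C] [AddCommGroup P] [Module S P] [AddCommGroup X]

/-- The class of `c ⊗ p` in `C ⊗_S P`. -/
def tmul (c : C) (p : P) : BalancedTensor R S C P := Submodule.Quotient.mk (c ⊗ₜ[ℤ] p)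

lemma add_tmul (c c' : C) (p : P) : tmul R S (c + c') p = tmul R S c p + tmul R S c' p :=
  congrArg Submodule.Quotient.mk (TensorProduct.add_tmul c c' p)

lemma tmul_add (c : C) (p p' : P) : tmul R S c (p + p') = tmul R S c p + tmul R S c p' :=
  congrArg Submodule.Quotient.mk (TensorProduct.tmul_add c p p')

/-- The universal balanced biadditive map `c ↦ p ↦ c ⊗ p`. -/
def tmulHom : C →+ P →+ BalancedTensor R S C P :=
  AddMonoidHom.mk' (fun c => AddMonoidHom.mk' (tmul R S c) (tmul_add R S c))
    fun c c' => AddMonoidHom.ext fun p => add_tmul R S c c' p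

@[simp] lemma zero_tmul (p : P) : tmul R S (0 : C) p = 0 :=
  DFunLike.congr_fun (map_zero (tmulHom R S (C := C))) p

@[simp] lemma tmul_zero (c : C) : tmul R S c (0 : P) = 0 := map_zero (tmulHom R S c)

lemma sum_tmul {ι : Type*} (s : Finset ι) (c : ι → C) (p : P) :
    tmul R S (∑ i ∈ s, c i) p = ∑ i ∈ s, tmul R S (c i) p :=
  map_sum ((tmulHom R S).flip p) c s

lemma tmul_sum {ι : Type*} (s : Finset ι) (c : C) (p : ι → P) :
    tmul R S c (∑ i ∈ s, p i) = ∑ i ∈ s, tmul R S c (p i) :=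
  map_sum (tmulHom R S c) p s

lemma smul_tmul' (r : R) (c : C) (p : P) : r • tmul R S c p = tmul R S (r • c) p := rfl

lemma smul_tmul (a : Sᵐᵒᵖ) (c : C) (p : P) : tmul R S (a • c) p = tmul R S c (a.unop • p) :=
  (Submodule.Quotient.eq _).2 (Submodule.subset_span ⟨c, a.unop, p, rfl⟩)

lemma tmul_eq_one_tmul [Module R S] (s : S) (p : P) : tmul R S s p = tmul R S 1 (s • p) := by
  simpa using smul_tmul R S (MulOpposite.op s) (1 : S) p

variable {R S}

@[elab_as_elim]
lemma induction_on {motive : BalancedTensor R S C P → Prop} (t : BalancedTensor R S C P)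
    (zero : motive 0) (tmul : ∀ c p, motive (tmul R S c p))
    (add : ∀ x y, motive x → motive y → motive (x + y)) : motive t := by
  obtain ⟨t, rfl⟩ := Submodule.Quotient.mk_surjective _ t
  induction t using TensorProduct.induction_on with
  | zero => exact zero
  | tmul c p => exact tmul c p
  | add x y hx hy => exact add _ _ hx hy

lemma exists_eq_sum_tmul (t : BalancedTensor R S C P) :
    ∃ (n : ℕ) (c : Fin n → C) (p : Fin n → P), t = ∑ k, tmul R S (c k) (p k) := by
  induction t using induction_on with
  | zero => exact ⟨0, Fin.elim0, Fin.elim0, by simp⟩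
  | tmul c p => exact ⟨1, fun _ => c, fun _ => p, by simp⟩
  | add x y hx hy =>
    obtain ⟨n, c, p, rfl⟩ := hx
    obtain ⟨m, d, q, rfl⟩ := hy
    exact ⟨n + m, Fin.append c d, Fin.append p q, by simp [Fin.sum_univ_add]⟩

lemma addHom_ext {f g : BalancedTensor R S C P →+ X}
    (h : ∀ c p, f (tmul R S c p) = g (tmul R S c p)) : f = g := by
  ext t
  induction t using induction_on with
  | zero => simp only [map_zero]
  | tmul c p => exact h c p
  | add x y hx hy => rw [map_add, map_add, hx, hy]

lemma linearMap_ext [Module R X] {f g : BalancedTensor R S C P →ₗ[R] X}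
    (h : ∀ c p, f (tmul R S c p) = g (tmul R S c p)) : f = g :=
  LinearMap.toAddMonoidHom_injective (addHom_ext h)

end Basic

section Lift

variable (R : Type*) {S C P X : Type*} [Ring R] [Ring S]
  [AddCommGroup C] [Module R C] [Module Sᵐᵒᵖ C] [SMulCommClass R Sᵐᵒᵖ C]
  [AddCommGroup P] [Module S P] [AddCommGroup X]

lemma balancedRelations_le_ker_liftAddHom (B : C →+ P →+ X)
    (hB : ∀ (a : Sᵐᵒᵖ) c p, B (a • c) p = B c (a.unop • p)) :
    (balancedRelations R S C P).toAddSubgroup ≤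
      (TensorProduct.liftAddHom B fun n c p => by simp : C ⊗[ℤ] P →+ X).ker := by
  intro t ht
  obtain ⟨n, r, x, rfl⟩ := Submodule.mem_span_set'.1 ht
  rw [AddMonoidHom.mem_ker, map_sum]
  refine Finset.sum_eq_zero fun i _ => ?_
  obtain ⟨c, s, p, hx⟩ := (x i).2
  rw [hx, smul_sub, TensorProduct.smul_tmul', TensorProduct.smul_tmul', smul_comm, map_sub,
    sub_eq_zero]
  exact hB (MulOpposite.op s) (r i • c) p

/-- The additive map out of `C ⊗_S P` induced by a balanced biadditive map. -/
noncomputable def lift (B : C →+ P →+ X)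
    (hB : ∀ (a : Sᵐᵒᵖ) c p, B (a • c) p = B c (a.unop • p)) : BalancedTensor R S C P →+ X :=
  QuotientAddGroup.lift _ _ (balancedRelations_le_ker_liftAddHom R B hB)

/-- The `R`-linear map out of `C ⊗_S P` induced by a balanced biadditive map that is `R`-linear in
the first variable. -/
noncomputable def liftₗ [Module R X] (B : C →+ P →+ X)
    (hB : ∀ (a : Sᵐᵒᵖ) c p, B (a • c) p = B c (a.unop • p))
    (hR : ∀ (r : R) c p, B (r • c) p = r • B c p) : BalancedTensor R S C P →ₗ[R] X where
  __ := lift R B hB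
  map_smul' r t := by
    change lift R B hB _ = r • lift R B hB _
    induction t using induction_on with
    | zero => simp only [smul_zero, map_zero]
    | tmul c p => exact hR r c p
    | add x y hx hy => rw [smul_add, map_add, map_add, hx, hy, smul_add]

variable (S) in
/-- Forgetting the left action on `C ⊗_S P`. -/
noncomputable def forget : BalancedTensor R S C P ≃+ BalancedTensor ℤ S C P :=
  AddMonoidHom.toAddEquiv (lift R (tmulHom ℤ S) (smul_tmul ℤ S))
    (lift ℤ (tmulHom R S) (smul_tmul R S)) (addHom_ext fun _ _ => rfl) (addHom_ext fun _ _ => rfl)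

@[simp] lemma forget_tmul (c : C) (p : P) : forget R S (tmul R S c p) = tmul ℤ S c p := rfl

end Lift

section Functoriality

variable {R S C N N' P P' Q : Type*} [Ring R] [Ring S]
  [AddCommGroup C] [Module R C] [Module Sᵐᵒᵖ C] [SMulCommClass R Sᵐᵒᵖ C]
  [AddCommGroup N] [Module Sᵐᵒᵖ N] [AddCommGroup N'] [Module Sᵐᵒᵖ N']
  [AddCommGroup P] [Module S P] [AddCommGroup P'] [Module S P'] [AddCommGroup Q] [Module S Q]

@[simp] lemma balancedTensorMap_tmul (f : N →ₗ[Sᵐᵒᵖ] N') (n : N) (p : P) :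
    balancedTensorMap f P (tmul ℤ S n p) = tmul ℤ S (f n) p := rfl

variable (R C) in
/-- The map `C ⊗_S g : C ⊗_S P → C ⊗_S P'` induced by `g : P → P'`. -/
noncomputable def lTensor (g : P →ₗ[S] P') :
    BalancedTensor R S C P →ₗ[R] BalancedTensor R S C P' :=
  liftₗ R (g.toAddMonoidHom.compHom'.comp (tmulHom R S))
    (fun a c p => (smul_tmul R S a c (g p)).trans (congrArg _ (map_smul g a.unop p).symm))
    fun _ _ _ => rfl

@[simp] lemma lTensor_tmul (g : P →ₗ[S] P') (c : C) (p : P) :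
    lTensor R C g (tmul R S c p) = tmul R S c (g p) := rfl

lemma lTensor_balancedTensorMap (f : N →ₗ[Sᵐᵒᵖ] N') (g : P →ₗ[S] P')
    (t : BalancedTensor ℤ S N P) :
    lTensor ℤ N' g (balancedTensorMap f P t) = balancedTensorMap f P' (lTensor ℤ N g t) := by
  induction t using induction_on with
  | zero => simp only [map_zero]
  | tmul n p => rfl
  | add x y hx hy => simp only [map_add, hx, hy]

lemma lTensor_surjective {g : P →ₗ[S] P'} (hg : Function.Surjective g) :
    Function.Surjective (lTensor R C g) := by
  intro t
  induction t using induction_on with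
  | zero => exact ⟨0, map_zero _⟩
  | tmul c p =>
    obtain ⟨q, rfl⟩ := hg p
    exact ⟨tmul R S c q, lTensor_tmul g c q⟩
  | add x y hx hy =>
    obtain ⟨x, rfl⟩ := hx
    obtain ⟨y, rfl⟩ := hy
    exact ⟨x + y, map_add _ _ _⟩

variable (R S N P) [Module R N] [SMulCommClass R Sᵐᵒᵖ N] in
/-- The adjunction between `- ⊗_S P` and `Hom(P, -)` for characters: the characters of `N ⊗_S P`
are the `S`-linear maps from `N` to the character module of `P`. -/
noncomputable def characterEquiv :
    (N →ₗ[Sᵐᵒᵖ] CharacterModule P) ≃+ CharacterModule (BalancedTensor R S N P) where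
  toFun h := lift R (AddMonoidHom.mk' (fun n => (h n : P →+ AddCircle (1 : ℚ))) (map_add h))
    fun a n p => DFunLike.congr_fun (map_smul h a n) p
  invFun χ :=
    { toFun := fun n => AddMonoidHom.comp χ (tmulHom R S n)
      map_add' := fun n n' => CharacterModule.ext _ fun p =>
        (congrArg χ (add_tmul R S n n' p)).trans (map_add χ _ _)
      map_smul' := fun a n => CharacterModule.ext _ fun p => congrArg χ (smul_tmul R S a n p) }
  left_inv _ := rfl
  right_inv _ := addHom_ext fun _ _ => rfl
  map_add' _ _ := addHom_ext fun _ _ => rfl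

section

variable [Module R N] [SMulCommClass R Sᵐᵒᵖ N]

lemma injective_of_forall_exists_character {X : Type*} [AddCommGroup X]
    (f : BalancedTensor R S N P →+ X)
    (hf : ∀ h : N →ₗ[Sᵐᵒᵖ] CharacterModule P, ∃ ψ : CharacterModule X,
      ∀ n p, ψ (f (tmul R S n p)) = h n p) : Function.Injective f := by
  rw [injective_iff_map_eq_zero]
  refine fun t ht => CharacterModule.eq_zero_of_character_apply fun χ => ?_
  obtain ⟨ψ, hψ⟩ := hf ((characterEquiv R S N P).symm χ)
  have hχ : AddMonoidHom.comp ψ f = χ := addHom_ext fun n p => hψ n p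
  rw [← hχ]
  exact (congrArg ψ ht).trans (map_zero ψ)

end

lemma lTensor_exact {i : P →ₗ[S] P'} {g : P' →ₗ[S] Q} (hg : Function.Surjective g)
    (hex : Function.Exact i g) : Function.Exact (lTensor R C i) (lTensor R C g) := by
  refine fun t => ⟨fun ht => ?_, ?_⟩
  · refine mem_of_forall_character (K := (lTensor R C i).toAddMonoidHom.range) fun χ hχ => ?_
    let h := (characterEquiv R S C P').symm χ
    have hker : ∀ c, h c ∈ LinearMap.range (characterMap g) := fun c =>
      (characterMap_exact hex (h c)).1 (CharacterModule.ext _ fun p => hχ ⟨tmul R S c p, rfl⟩)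
    let h' : C →ₗ[Sᵐᵒᵖ] CharacterModule Q :=
      (LinearEquiv.ofInjective _ (characterMap_injective hg)).symm ∘ₗ h.codRestrict _ hker
    have hh' : ∀ c, characterMap g (h' c) = h c := fun c =>
      congrArg Subtype.val ((LinearEquiv.ofInjective _ (characterMap_injective hg)).apply_symm_apply
        (h.codRestrict _ hker c))
    have hfactor : AddMonoidHom.comp (characterEquiv R S C Q h')
        (lTensor R C g).toAddMonoidHom = χ :=
      addHom_ext fun c p => DFunLike.congr_fun (hh' c) p
    rw [← hfactor]
    exact (congrArg _ ht).trans (map_zero (characterEquiv R S C Q h'))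
  · rintro ⟨t, rfl⟩
    induction t using induction_on with
    | zero => simp only [map_zero]
    | tmul c p => simp only [lTensor_tmul, hex.apply_apply_eq_zero, tmul_zero]
    | add x y hx hy => rw [map_add, map_add, hx, hy, add_zero]

end Functoriality

section Finsupp

variable {R S C P : Type*} [Ring R] [Ring S] [AddCommGroup C] [Module R C] [Module Sᵐᵒᵖ C]
  [AddCommGroup P] [Module S P]

variable (R S C) in
/-- The map `c ↦ c ⊗ p`. -/
def tmulRight (p : P) : C →ₗ[R] BalancedTensor R S C P where
  __ := (tmulHom R S).flip p
  map_smul' r c := smul_tmul' R S r c p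

@[simp] lemma tmulRight_apply (p : P) (c : C) : tmulRight R S C p c = tmul R S c p := rfl

variable [SMulCommClass R Sᵐᵒᵖ C] (ι : Type*)

variable (R S C) in
/-- The map `C ⊗_S S^(ι) → C^(ι)`, `c ⊗ v ↦ (c v i)ᵢ`. -/
noncomputable def toFinsupp : BalancedTensor R S C (ι →₀ S) →ₗ[R] (ι →₀ C) :=
  liftₗ R (AddMonoidHom.mk' (fun c => Finsupp.mapRange.addMonoidHom
      (((smulAddHom Sᵐᵒᵖ C).flip c).comp (MulOpposite.opAddEquiv (α := S)).toAddMonoidHom))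
      fun c c' => AddMonoidHom.ext fun v => Finsupp.ext fun i =>
        smul_add (MulOpposite.op (v i)) c c')
    (fun a c v => Finsupp.ext fun i => smul_smul (MulOpposite.op (v i)) a c)
    fun r c v => Finsupp.ext fun i => (smul_comm r (MulOpposite.op (v i)) c).symm

lemma toFinsupp_tmul_apply (c : C) (v : ι →₀ S) (i : ι) :
    toFinsupp R S C ι (tmul R S c v) i = MulOpposite.op (v i) • c := rfl

lemma toFinsupp_tmul_single (c : C) (i : ι) (s : S) :
    toFinsupp R S C ι (tmul R S c (Finsupp.single i s)) =
      Finsupp.single i (MulOpposite.op s • c) :=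
  Finsupp.mapRange_single (hf := map_zero _)

variable (R S C) in
/-- The isomorphism `C ⊗_S S^(ι) ≃ C^(ι)`. -/
noncomputable def finsuppEquiv : BalancedTensor R S C (ι →₀ S) ≃ₗ[R] (ι →₀ C) :=
  LinearEquiv.ofLinearMap (toFinsupp R S C ι)
    (Finsupp.lsum ℕ fun i => tmulRight R S C (Finsupp.single i 1))
    (Finsupp.lhom_ext fun i c => by simp [toFinsupp_tmul_single])
    (linearMap_ext fun c v => by
      induction v using Finsupp.induction_linear with
      | zero => simp only [tmul_zero, map_zero]
      | add v w hv hw => rw [tmul_add, map_add, map_add, hv, hw]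
      | single i s => simp [toFinsupp_tmul_single, smul_tmul])

end Finsupp

end BalancedTensor

/-! ### Vanishing sums of tensors -/

open BalancedTensor

section Relations

lemma linearCombination_eq_sum {T A ι : Type*} [Ring T] [AddCommGroup A] [Module T A] [Fintype ι]
    (v : ι → A) (k : ι →₀ T) : Finsupp.linearCombination T v k = ∑ i, k i • v i :=
  Finsupp.sum_fintype _ _ fun i => zero_smul T (v i)

lemma exists_linearMap_of_relations {T A B ι Λ : Type*} [Ring T] [AddCommGroup A] [Module T A]
    [AddCommGroup B] [Module T B] {x : ι → A} (hx : Submodule.span T (Set.range x) = ⊤)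
    {κ : Λ → ι →₀ T}
    (hκ : LinearMap.ker (Finsupp.linearCombination T x) ≤ Submodule.span T (Set.range κ))
    {e : ι → B} (he : ∀ l, Finsupp.linearCombination T e (κ l) = 0) :
    ∃ f : A →ₗ[T] B, ∀ i, f (x i) = e i := by
  let π := Finsupp.linearCombination T x
  have hπ : Function.Surjective π := by
    rw [← LinearMap.range_eq_top, Finsupp.range_linearCombination, hx]
  have hker : LinearMap.ker π ≤ LinearMap.ker (Finsupp.linearCombination T e) :=
    hκ.trans (Submodule.span_le.2 (Set.range_subset_iff.2 he))
  refine ⟨(LinearMap.ker π).liftQ _ hker ∘ₗ (π.quotKerEquivOfSurjective hπ).symm, fun i => ?_⟩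
  have hi : (π.quotKerEquivOfSurjective hπ).symm (x i) =
      (LinearMap.ker π).mkQ (Finsupp.single i 1) := by
    rw [LinearEquiv.symm_apply_eq]
    simp [π]
  simp [hi]

lemma exists_finite_presentation (T A : Type*) [Ring T] [AddCommGroup A] [Module T A]
    [Module.FinitePresentation T A] :
    ∃ (n m : ℕ) (x : Fin n → A) (κ : Fin m → Fin n →₀ T),
      Submodule.span T (Set.range x) = ⊤ ∧
      Submodule.span T (Set.range κ) = LinearMap.ker (Finsupp.linearCombination T x) := by
  obtain ⟨n, x, hx⟩ := Submodule.fg_iff_exists_fin_generating_family.1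
    (Module.Finite.fg_top (R := T) (M := A))
  have hsurj : Function.Surjective (Finsupp.linearCombination T x) := by
    rw [← LinearMap.range_eq_top, Finsupp.range_linearCombination, hx]
  obtain ⟨m, κ, hκ⟩ := Submodule.fg_iff_exists_fin_generating_family.1
    (Module.FinitePresentation.fg_ker _ hsurj)
  exact ⟨n, m, x, κ, hx, hκ⟩

lemma span_range_subtype_eq_top {T A ι : Type*} [Ring T] [AddCommGroup A] [Module T A]
    (x : ι → A) :
    Submodule.span T (Set.range fun i =>
      (⟨x i, Submodule.subset_span ⟨i, rfl⟩⟩ : Submodule.span T (Set.range x))) = ⊤ := by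
  apply Submodule.map_injective_of_injective (Submodule.injective_subtype _)
  rw [Submodule.map_span, ← Set.range_comp, Submodule.map_top, Submodule.range_subtype]
  rfl

end Relations

section VanishingTensors

variable {R S C P ι Λ : Type*} [Ring R] [Ring S] [AddCommGroup P] [Module S P]

section

variable [AddCommGroup C] [Module R C] [Module Sᵐᵒᵖ C]

variable (R S P) in
/-- The map `P^(ι) → C ⊗_S P`, `p ↦ ∑ i, x i ⊗ p i`, given by a family `x` in `C`. -/
noncomputable def finsuppTmul (x : ι → C) : (ι →₀ P) →+ BalancedTensor R S C P :=
  Finsupp.liftAddHom fun i => tmulHom R S (x i)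

@[simp] lemma finsuppTmul_single (x : ι → C) (i : ι) (p : P) :
    finsuppTmul R S P x (Finsupp.single i p) = tmul R S (x i) p :=
  Finsupp.liftAddHom_apply_single _ i p

lemma finsuppTmul_apply [Fintype ι] (x : ι → C) (p : ι →₀ P) :
    finsuppTmul R S P x p = ∑ i, tmul R S (x i) (p i) :=
  Finsupp.sum_fintype _ _ fun i => tmul_zero R S (x i)

end

variable (P) in
/-- The map `P^(Λ) → P^(ι)` given by a family, indexed by `Λ`, of columns in `S^(ι)`. A column is
kept as a vector over `Sᵐᵒᵖ` because it arises as a relation between elements of a right module. -/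
noncomputable def columnMap (κ : Λ → ι →₀ Sᵐᵒᵖ) : (Λ →₀ P) →+ (ι →₀ P) :=
  Finsupp.liftAddHom fun l => AddMonoidHom.mk'
    (fun p => (κ l).mapRange (fun a => a.unop • p) (zero_smul S p))
    fun p p' => Finsupp.ext fun i => smul_add (κ l i).unop p p'

lemma columnMap_single (κ : Λ → ι →₀ Sᵐᵒᵖ) (l : Λ) (p : P) :
    columnMap P κ (Finsupp.single l p) =
      (κ l).mapRange (fun a => a.unop • p) (zero_smul S p) :=
  Finsupp.liftAddHom_apply_single _ l p

lemma columnMap_apply [Fintype Λ] (κ : Λ → ι →₀ Sᵐᵒᵖ) (q : Λ →₀ P) (i : ι) :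
    columnMap P κ q i = ∑ l, (κ l i).unop • q l := by
  rw [columnMap, Finsupp.liftAddHom_apply, Finsupp.sum_fintype _ _ fun _ => map_zero _,
    Finsupp.finsetSum_apply]
  rfl

lemma lTensor_finsuppTmul [AddCommGroup C] [Module R C] [Module Sᵐᵒᵖ C] [SMulCommClass R Sᵐᵒᵖ C]
    {P' : Type*} [AddCommGroup P'] [Module S P'] (g : P →ₗ[S] P') (x : ι → C) (p : ι →₀ P) :
    lTensor R C g (finsuppTmul R S P x p) =
      finsuppTmul R S P' x (p.mapRange g (map_zero g)) := by
  induction p using Finsupp.induction_linear with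
  | zero => simp only [Finsupp.mapRange_zero, map_zero]
  | add p p' hp hp' => rw [map_add, map_add, hp, hp', Finsupp.mapRange_add (map_add g), map_add]
  | single i p => simp

lemma finsuppTmul_columnMap [AddCommGroup C] [Module R C] [Module Sᵐᵒᵖ C] {x : ι → C}
    {κ : Λ → ι →₀ Sᵐᵒᵖ} (hκ : ∀ l, Finsupp.linearCombination Sᵐᵒᵖ x (κ l) = 0) (q : Λ →₀ P) :
    finsuppTmul R S P x (columnMap P κ q) = 0 := by
  have hsingle : ∀ (k : ι →₀ Sᵐᵒᵖ) (q : P),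
      finsuppTmul R S P x (k.mapRange (fun a => a.unop • q) (zero_smul S q)) =
        tmul R S (Finsupp.linearCombination Sᵐᵒᵖ x k) q := fun k q => by
    induction k using Finsupp.induction_linear with
    | zero => simp only [Finsupp.mapRange_zero, map_zero, zero_tmul]
    | add k k' hk hk' =>
      rw [Finsupp.mapRange_add fun a b => add_smul a.unop b.unop q, map_add, map_add, hk, hk',
        add_tmul]
    | single i a => simp [smul_tmul]
  induction q using Finsupp.induction_linear with
  | zero => simp only [map_zero]
  | add q q' hq hq' => rw [map_add, map_add, hq, hq', add_zero]
  | single l q => rw [columnMap_single, hsingle, hκ, zero_tmul]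

lemma exists_columnMap_eq [AddCommGroup C] [Module R C] [Module Sᵐᵒᵖ C] [SMulCommClass R Sᵐᵒᵖ C]
    {x : ι → C} (hx : Submodule.span Sᵐᵒᵖ (Set.range x) = ⊤) {κ : Λ → ι →₀ Sᵐᵒᵖ}
    (hκ : LinearMap.ker (Finsupp.linearCombination Sᵐᵒᵖ x) ≤ Submodule.span Sᵐᵒᵖ (Set.range κ))
    {p : ι →₀ P} (h : finsuppTmul R S P x p = 0) : ∃ q, columnMap P κ q = p := by
  refine mem_of_forall_character (K := (columnMap P κ).range) fun χ hχ => ?_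
  let e : ι → CharacterModule P := fun i => χ.comp (Finsupp.singleAddHom i)
  have he : ∀ k : ι →₀ Sᵐᵒᵖ, ∀ p : P, Finsupp.linearCombination Sᵐᵒᵖ e k p =
      χ (k.mapRange (fun a => a.unop • p) (zero_smul S p)) := by
    intro k p
    induction k using Finsupp.induction_linear with
    | zero => simp
    | add k k' hk hk' =>
      rw [map_add, character_add_apply, hk, hk', ← map_add,
        Finsupp.mapRange_add fun a b => add_smul a.unop b.unop p]
    | single i a =>
      rw [Finsupp.linearCombination_single, Finsupp.mapRange_single]
      rfl
  obtain ⟨f, hf⟩ := exists_linearMap_of_relations hx hκ (e := e) fun l =>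
    CharacterModule.ext _ fun p => by
      rw [he, ← columnMap_single]
      exact hχ ⟨_, rfl⟩
  let ψ : BalancedTensor R S C P →+ AddCircle (1 : ℚ) := characterEquiv R S C P f
  have hψ : χ = ψ.comp (finsuppTmul R S P x) := Finsupp.addHom_ext fun i p => by
    rw [AddMonoidHom.comp_apply, finsuppTmul_single]
    exact (DFunLike.congr_fun (hf i) p).symm
  rw [hψ, AddMonoidHom.comp_apply, h, map_zero]

lemma finsuppTmul_surjective [AddCommGroup C] [Module R C] [Module Sᵐᵒᵖ C]
    {x : ι → C} (hx : Submodule.span Sᵐᵒᵖ (Set.range x) = ⊤) :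
    Function.Surjective (finsuppTmul R S P x) := by
  intro t
  induction t using BalancedTensor.induction_on with
  | zero => exact ⟨0, map_zero _⟩
  | tmul c p =>
    have hc : c ∈ Submodule.span Sᵐᵒᵖ (Set.range x) := hx ▸ Submodule.mem_top
    obtain ⟨k, rfl⟩ := (Finsupp.mem_span_range_iff_exists_finsupp).1 hc
    refine ⟨k.sum fun i a => Finsupp.single i (a.unop • p), ?_⟩
    simp [Finsupp.sum, sum_tmul, smul_tmul]
  | add x y hx hy =>
    obtain ⟨x, rfl⟩ := hx
    obtain ⟨y, rfl⟩ := hy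
    exact ⟨x + y, map_add _ _ _⟩

lemma exists_eq_sum_tmul_of_span_eq_top [AddCommGroup C] [Module R C] [Module Sᵐᵒᵖ C] [Fintype ι]
    {x : ι → C} (hx : Submodule.span Sᵐᵒᵖ (Set.range x) = ⊤) (t : BalancedTensor R S C P) :
    ∃ p : ι → P, t = ∑ i, tmul R S (x i) (p i) := by
  obtain ⟨p, rfl⟩ := finsuppTmul_surjective hx t
  exact ⟨p, finsuppTmul_apply x p⟩

variable (S) in
/-- The vanishing of `∑ i, x i ⊗ p i` is explained by relations: the vector `p` is a combination of
columns that annihilate `x`. -/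
def VanishesTrivially {M : Type*} [AddCommGroup M] [Module Sᵐᵒᵖ M] [Fintype ι] (x : ι → M)
    (p : ι → P) : Prop :=
  ∃ (m : ℕ) (κ : Fin m → ι → Sᵐᵒᵖ) (q : Fin m → P),
    (∀ l, ∑ i, κ l i • x i = 0) ∧ ∀ i, p i = ∑ l, (κ l i).unop • q l

namespace VanishesTrivially

variable {M M' : Type*} [AddCommGroup M] [Module Sᵐᵒᵖ M] [AddCommGroup M'] [Module Sᵐᵒᵖ M']
  [Fintype ι] {x : ι → M} {p : ι → P}

lemma sum_tmul_eq_zero [Module R M] (h : VanishesTrivially S x p) :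
    ∑ i, tmul R S (x i) (p i) = 0 := by
  obtain ⟨m, κ, q, hκ, hp⟩ := h
  simp only [hp, tmul_sum, ← smul_tmul]
  rw [Finset.sum_comm]
  simp only [← sum_tmul, hκ, zero_tmul, Finset.sum_const_zero]

lemma of_injective {f : M →ₗ[Sᵐᵒᵖ] M'} (hf : Function.Injective f)
    (h : VanishesTrivially S (fun i => f (x i)) p) : VanishesTrivially S x p := by
  obtain ⟨m, κ, q, hκ, hp⟩ := h
  refine ⟨m, κ, q, fun l => hf ?_, hp⟩
  simp only [map_sum, map_smul, hκ, map_zero]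

lemma map (h : VanishesTrivially S x p) (f : M →ₗ[Sᵐᵒᵖ] M') :
    VanishesTrivially S (fun i => f (x i)) p := by
  obtain ⟨m, κ, q, hκ, hp⟩ := h
  refine ⟨m, κ, q, fun l => ?_, hp⟩
  simp only [← map_smul, ← map_sum, hκ, map_zero]

end VanishesTrivially

section

variable [AddCommGroup C] [Module R C] [Module Sᵐᵒᵖ C] [SMulCommClass R Sᵐᵒᵖ C] {x : ι → C}

lemma exists_relations_of_finsuppTmul_eq_zero (hx : Submodule.span Sᵐᵒᵖ (Set.range x) = ⊤)
    {p : ι →₀ P} (h : finsuppTmul R S P x p = 0) :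
    ∃ (m : ℕ) (κ : Fin m → ι →₀ Sᵐᵒᵖ) (q : Fin m → P),
      (∀ l, Finsupp.linearCombination Sᵐᵒᵖ x (κ l) = 0) ∧
        ∀ i, p i = ∑ l, (κ l i).unop • q l := by
  let κ : LinearMap.ker (Finsupp.linearCombination Sᵐᵒᵖ x) → ι →₀ Sᵐᵒᵖ := Subtype.val
  obtain ⟨q, rfl⟩ := exists_columnMap_eq hx (κ := κ)
    (fun k hk => Submodule.subset_span ⟨⟨k, hk⟩, rfl⟩) h
  let e := q.support.equivFin.symm
  refine ⟨q.support.card, fun l => κ (e l), fun l => q (e l), fun l => (e l).1.2, fun i => ?_⟩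
  rw [e.sum_comp fun l : q.support => (κ l i).unop • q l,
    Finset.sum_coe_sort q.support fun l => (κ l i).unop • q l]
  conv_lhs => rw [← q.sum_single, Finsupp.sum, map_sum]
  simp [columnMap_single]

lemma vanishesTrivially_of_sum_tmul_eq_zero [Fintype ι]
    (hx : Submodule.span Sᵐᵒᵖ (Set.range x) = ⊤) {p : ι → P}
    (h : ∑ i, tmul R S (x i) (p i) = 0) : VanishesTrivially S x p := by
  obtain ⟨m, κ, q, hκ, hq⟩ := exists_relations_of_finsuppTmul_eq_zero hx
    (p := Finsupp.equivFunOnFinite.symm p) ((finsuppTmul_apply x _).trans h)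
  refine ⟨m, fun l => κ l, q, fun l => ?_, hq⟩
  rw [← hκ l, linearCombination_eq_sum]

end

end VanishingTensors

/-! ### Flat modules -/

lemma injective_of_retract {T : Type*} {A B : Type u} [Ring T] [AddCommGroup A] [AddCommGroup B]
    [Module T A] [Module T B] (hB : Module.Injective T B) (j : A →ₗ[T] B) (r : B →ₗ[T] A)
    (h : r ∘ₗ j = LinearMap.id) : Module.Injective T A where
  out X Y _ _ _ _ f hf g := by
    obtain ⟨k, hk⟩ := hB.out f hf (j ∘ₗ g)
    exact ⟨r ∘ₗ k, fun x => (congrArg r (hk x)).trans (LinearMap.congr_fun h (g x))⟩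

section Flat

variable {S : Type u} [Ring S] {P : Type u} [AddCommGroup P] [Module S P]

theorem isFlat_iff_injective : IsFlat S P ↔ Module.Injective Sᵐᵒᵖ (CharacterModule P) := by
  refine ⟨fun hP => ⟨fun X Y _ _ _ _ f hf h => ?_⟩, fun hP X Y _ _ _ _ f hf => ?_⟩
  · obtain ⟨ψ, hψ⟩ := CharacterModule.dual_surjective_of_injective _ (hP X Y f hf)
      (characterEquiv ℤ S X P h)
    exact ⟨(characterEquiv ℤ S Y P).symm ψ, fun x => CharacterModule.ext _ fun p =>
      DFunLike.congr_fun hψ (tmul ℤ S x p)⟩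
  · refine injective_of_forall_exists_character (balancedTensorMap f P).toAddMonoidHom fun h => ?_
    obtain ⟨k, hk⟩ := hP.out f hf h
    exact ⟨characterEquiv ℤ S Y P k, fun x p => DFunLike.congr_fun (hk x) p⟩

theorem IsFlat.vanishesTrivially (hP : IsFlat S P) {R ι : Type*} {M : Type u} [Ring R]
    [AddCommGroup M] [Module R M] [Module Sᵐᵒᵖ M] [SMulCommClass R Sᵐᵒᵖ M] [Fintype ι]
    {x : ι → M} {p : ι → P} (h : ∑ i, tmul R S (x i) (p i) = 0) : VanishesTrivially S x p := by
  let M₀ := Submodule.span Sᵐᵒᵖ (Set.range x)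
  let y : ι → M₀ := fun i => ⟨x i, Submodule.subset_span ⟨i, rfl⟩⟩
  have hy : ∑ i, tmul ℤ S (y i) (p i) = 0 := by
    apply hP M₀ M M₀.subtype M₀.injective_subtype
    simpa [y] using congrArg (forget R S) h
  exact (vanishesTrivially_of_sum_tmul_eq_zero (span_range_subtype_eq_top x) hy).map M₀.subtype

theorem isFlat_of_vanishesTrivially
    (h : ∀ (n : ℕ) (s : Fin n → S) (p : Fin n → P), ∑ i, s i • p i = 0 →
      VanishesTrivially S s p) : IsFlat S P := by
  rw [isFlat_iff_injective]
  refine Module.Baer.injective fun I g => ?_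
  let μ : BalancedTensor ℤ S I P →+ P := lift ℤ
    (AddMonoidHom.mk' (fun x => DistribSMul.toAddMonoidHom P (x : Sᵐᵒᵖ).unop) fun x y =>
      AddMonoidHom.ext fun p => add_smul _ _ p)
    fun a x p => mul_smul (x : Sᵐᵒᵖ).unop a.unop p
  have hμ : Function.Injective μ := by
    rw [injective_iff_map_eq_zero]
    intro t ht
    obtain ⟨n, x, p, rfl⟩ := exists_eq_sum_tmul t
    rw [map_sum] at ht
    have hx := (h n (fun i => (x i : Sᵐᵒᵖ).unop) p ht).map
      (MulOpposite.opLinearEquiv Sᵐᵒᵖ).toLinearMap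
    exact (hx.of_injective (f := I.subtype) (x := x) I.injective_subtype).sum_tmul_eq_zero
  obtain ⟨φ, hφ⟩ := exists_character_comp_eq μ (characterEquiv ℤ S I P g) <| by
    rw [(AddMonoidHom.ker_eq_bot_iff μ).2 hμ]
    exact bot_le
  exact ⟨LinearMap.toSpanSingleton Sᵐᵒᵖ _ φ, fun x hx => CharacterModule.ext _ fun p =>
    hφ (tmul ℤ S ⟨x, hx⟩ p)⟩

theorem isFlat_of_forall_fg_ideal
    (h : ∀ I : Submodule Sᵐᵒᵖ S, I.FG → Function.Injective (balancedTensorMap I.subtype P)) :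
    IsFlat S P := by
  refine isFlat_of_vanishesTrivially fun n s p hp => ?_
  let I := Submodule.span Sᵐᵒᵖ (Set.range s)
  let y : Fin n → I := fun i => ⟨s i, Submodule.subset_span ⟨i, rfl⟩⟩
  have hy : ∑ i, tmul ℤ S (y i) (p i) = 0 := by
    apply h I (Submodule.fg_span (Set.finite_range s))
    simp [y, tmul_eq_one_tmul ℤ S (s _), ← tmul_sum, hp]
  exact (vanishesTrivially_of_sum_tmul_eq_zero (span_range_subtype_eq_top s) hy).map I.subtype

lemma isFlat_finsupp (ι : Type u) : IsFlat S (ι →₀ S) := by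
  intro N N' _ _ _ _ f hf
  have hcomm : ∀ t, toFinsupp ℤ S N' ι (balancedTensorMap f (ι →₀ S) t) =
      Finsupp.mapRange f (map_zero f) (toFinsupp ℤ S N ι t) := by
    intro t
    induction t using BalancedTensor.induction_on with
    | zero => simp
    | tmul n v =>
      ext i
      simp [toFinsupp_tmul_apply]
    | add x y hx hy => rw [map_add, map_add, map_add, hx, hy, Finsupp.mapRange_add (map_add f)]
  refine Function.Injective.of_comp (f := toFinsupp ℤ S N' ι) ?_
  rw [show toFinsupp ℤ S N' ι ∘ balancedTensorMap f (ι →₀ S) =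
    Finsupp.mapRange f (map_zero f) ∘ toFinsupp ℤ S N ι from funext hcomm]
  exact (Finsupp.mapRange_injective f (map_zero f) hf).comp (finsuppEquiv ℤ S N ι).injective

section ShortExact

variable {K F Q : Type u} [AddCommGroup K] [Module S K] [AddCommGroup F] [Module S F]
  [AddCommGroup Q] [Module S Q] {i : K →ₗ[S] F} {g : F →ₗ[S] Q}

lemma IsFlat.exists_characterMap_section (hQ : IsFlat S Q) (hi : Function.Injective i)
    (hg : Function.Surjective g) (hex : Function.Exact i g) :
    ∃ σ : CharacterModule K →ₗ[Sᵐᵒᵖ] CharacterModule F, characterMap i ∘ₗ σ = LinearMap.id := by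
  obtain ⟨r, hr⟩ := (isFlat_iff_injective.1 hQ).out (characterMap g) (characterMap_injective hg)
    LinearMap.id
  have hsplit := ((characterMap_exact hex).split_tfae' (R := Sᵐᵒᵖ)).out 1 0
  exact (hsplit.1 ⟨characterMap_surjective hi, r, LinearMap.ext hr⟩).2

lemma IsFlat.lTensor_injective {R C : Type*} [Ring R] [AddCommGroup C] [Module R C]
    [Module Sᵐᵒᵖ C] [SMulCommClass R Sᵐᵒᵖ C] (hQ : IsFlat S Q) (hi : Function.Injective i)
    (hg : Function.Surjective g) (hex : Function.Exact i g) :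
    Function.Injective (lTensor R C i) := by
  obtain ⟨σ, hσ⟩ := hQ.exists_characterMap_section hi hg hex
  exact injective_of_forall_exists_character (lTensor R C i).toAddMonoidHom fun h =>
    ⟨characterEquiv R S C F (σ ∘ₗ h), fun c p =>
      DFunLike.congr_fun (LinearMap.congr_fun hσ (h c)) p⟩

lemma IsFlat.kernel (hQ : IsFlat S Q) (hF : IsFlat S F) (hi : Function.Injective i)
    (hg : Function.Surjective g) (hex : Function.Exact i g) : IsFlat S K := by
  obtain ⟨σ, hσ⟩ := hQ.exists_characterMap_section hi hg hex
  exact isFlat_iff_injective.2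
    (injective_of_retract (isFlat_iff_injective.1 hF) σ (characterMap i) hσ)

end ShortExact

lemma isFlat_doubleDual_quotient (h : IsFlat S (CharacterModule (CharacterModule P))) :
    IsFlat S (CharacterModule (CharacterModule P) ⧸ LinearMap.range (doubleDualEval S P)) := by
  let π := (LinearMap.range (doubleDualEval S P)).mkQ
  have hπ : Function.Surjective π := Submodule.mkQ_surjective _
  have hex : Function.Exact (doubleDualEval S P) π := LinearMap.exact_map_mkQ_range _
  have hsplit := ((characterMap_exact hex).split_tfae' (R := Sᵐᵒᵖ)).out 0 1
  obtain ⟨-, r, hr⟩ := hsplit.1 ⟨characterMap_injective hπ,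
    doubleDualEvalOp S _, characterMap_doubleDualEval_comp_doubleDualEvalOp⟩
  exact isFlat_iff_injective.2 (injective_of_retract (isFlat_iff_injective.1 h) _ r hr)

end Flat

/-! ### Finitely presented and coherent coefficients -/

section FinitePresentation

lemma character_pi_apply {ι : Type*} [Fintype ι] [DecidableEq ι] {A : ι → Type*}
    [∀ i, AddCommGroup (A i)] (χ : (∀ i, A i) →+ AddCircle (1 : ℚ)) (a : ∀ i, A i) :
    χ a = ∑ i, χ.comp (AddMonoidHom.single A i) (a i) := by
  conv_lhs => rw [← Finset.univ_sum_single a, map_sum]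
  rfl

variable {R S C : Type*} [Ring R] [Ring S] [AddCommGroup C] [Module R C] [Module Sᵐᵒᵖ C]
  [SMulCommClass R Sᵐᵒᵖ C]

section HomEval

variable {E : Type*} [AddCommGroup E] [Module Sᵐᵒᵖ E]

variable (R S C E) in
/-- The evaluation map `C ⊗_S E⁺ → Hom(C, E)⁺`, `c ⊗ φ ↦ (f ↦ φ (f c))`. -/
noncomputable def homEval :
    BalancedTensor R S C (CharacterModule E) →+ CharacterModule (C →ₗ[Sᵐᵒᵖ] E) :=
  lift R (AddMonoidHom.mk' (fun c => AddMonoidHom.compHom'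
      (AddMonoidHom.mk' (fun f : C →ₗ[Sᵐᵒᵖ] E => f c) fun _ _ => rfl))
      fun c c' => AddMonoidHom.ext fun φ => CharacterModule.ext _ fun f =>
        (congrArg φ (map_add f c c')).trans (map_add φ _ _))
    fun a c φ => CharacterModule.ext _ fun f => congrArg φ (map_smul f a c)

@[simp] lemma homEval_tmul (c : C) (φ : CharacterModule E) (f : C →ₗ[Sᵐᵒᵖ] E) :
    homEval R S C E (tmul R S c φ) f = φ (f c) := rfl

lemma homEval_balancedTensorMap {N N' : Type*} [AddCommGroup N] [AddCommGroup N']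
    [Module Sᵐᵒᵖ N] [Module Sᵐᵒᵖ N'] (f : N →ₗ[Sᵐᵒᵖ] N')
    (t : BalancedTensor ℤ S N (CharacterModule E)) (h : N' →ₗ[Sᵐᵒᵖ] E) :
    homEval ℤ S N' E (balancedTensorMap f _ t) h = homEval ℤ S N E t (h ∘ₗ f) := by
  induction t using BalancedTensor.induction_on with
  | zero => simp
  | tmul n φ => simp
  | add x y hx hy => simp only [map_add, character_add_apply, hx, hy]

lemma vanishesTrivially_of_forall_hom {n m : ℕ} {x : Fin n → C}
    (hx : Submodule.span Sᵐᵒᵖ (Set.range x) = ⊤) {κ : Fin m → Fin n →₀ Sᵐᵒᵖ}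
    (hκ : Submodule.span Sᵐᵒᵖ (Set.range κ) = LinearMap.ker (Finsupp.linearCombination Sᵐᵒᵖ x))
    {φ : Fin n → CharacterModule E} (h : ∀ f : C →ₗ[Sᵐᵒᵖ] E, ∑ i, φ i (f (x i)) = 0) :
    VanishesTrivially S x φ := by
  let ν : (Fin n → E) →+ (Fin m → E) := AddMonoidHom.mk'
    (fun e l => ∑ i, κ l i • e i) fun e e' => funext fun l => by
      simp [Finset.sum_add_distrib]
  let Φ : (Fin n → E) →+ AddCircle (1 : ℚ) := AddMonoidHom.mk' (fun e => ∑ i, φ i (e i))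
    fun e e' => by simp [Finset.sum_add_distrib]
  have hker : ν.ker ≤ Φ.ker := fun e he => by
    obtain ⟨f, hf⟩ := exists_linearMap_of_relations hx hκ.ge (e := e) fun l => by
      rw [linearCombination_eq_sum]
      exact congrFun he l
    exact (Finset.sum_congr rfl fun i _ => congrArg (φ i) (hf i).symm).trans (h f)
  obtain ⟨ψ, hψ⟩ : ∃ ψ : (Fin m → E) →+ AddCircle (1 : ℚ), ∀ e, ψ (ν e) = Φ e :=
    exists_character_comp_eq ν Φ hker
  refine ⟨m, fun l => κ l, fun l => AddMonoidHom.comp ψ (AddMonoidHom.single (fun _ => E) l),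
    fun l => ?_, fun i => CharacterModule.ext _ fun e => ?_⟩
  · rw [← linearCombination_eq_sum]
    exact hκ.le (Submodule.subset_span ⟨l, rfl⟩)
  · calc φ i e = Φ (Pi.single i e) :=
        .symm <| (Fintype.sum_eq_single i fun j hj => by
          rw [Pi.single_eq_of_ne hj, map_zero]).trans (by rw [Pi.single_eq_same])
      _ = ψ (ν (Pi.single i e)) := (hψ _).symm
      _ = _ := by
        rw [character_pi_apply ψ, character_sum_apply]
        have hν : ∀ l, ν (Pi.single i e) l = κ l i • e := fun l => by simp [ν, Pi.single_apply]
        exact Finset.sum_congr rfl fun l _ => by rw [hν]; rfl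

variable [Module.FinitePresentation Sᵐᵒᵖ C]

variable (R S C E) in
lemma homEval_injective : Function.Injective (homEval R S C E) := by
  rw [injective_iff_map_eq_zero]
  intro t ht
  obtain ⟨n, m, x, κ, hx, hκ⟩ := exists_finite_presentation Sᵐᵒᵖ C
  obtain ⟨φ, rfl⟩ := exists_eq_sum_tmul_of_span_eq_top hx t
  refine (vanishesTrivially_of_forall_hom hx hκ fun f => ?_).sum_tmul_eq_zero
  rw [map_sum] at ht
  simpa [character_sum_apply] using DFunLike.congr_fun ht f

variable (R S C E) in
lemma homEval_surjective : Function.Surjective (homEval R S C E) := by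
  intro Ψ
  obtain ⟨n, x, hx⟩ := Submodule.fg_iff_exists_fin_generating_family.1
    (Module.Finite.fg_top (R := Sᵐᵒᵖ) (M := C))
  let ν : (C →ₗ[Sᵐᵒᵖ] E) →+ (Fin n → E) := AddMonoidHom.mk' (fun f i => f (x i)) fun _ _ => rfl
  have hν : Function.Injective ν := fun f g h => LinearMap.ext_on_range hx (congrFun h)
  obtain ⟨ω, hω⟩ : ∃ ω : (Fin n → E) →+ AddCircle (1 : ℚ), ∀ f, ω (ν f) = Ψ f :=
    exists_character_comp_eq ν Ψ <| by
      rw [(AddMonoidHom.ker_eq_bot_iff ν).2 hν]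
      exact bot_le
  refine ⟨∑ i, tmul R S (x i) (AddMonoidHom.comp ω (AddMonoidHom.single (fun _ => E) i) :
    CharacterModule E), CharacterModule.ext _ fun f => ?_⟩
  rw [map_sum, character_sum_apply, ← hω, character_pi_apply ω]
  rfl

end HomEval

variable (R S C) in
/-- The isomorphism `C ⊗_S P⁺⁺ ≃ (C ⊗_S P)⁺⁺`: the map `homEval` for `E = P⁺`, combined with
`Hom(C, P⁺) ≃ (C ⊗_S P)⁺`. -/
noncomputable def tensorDoubleDualEquiv [Module.FinitePresentation Sᵐᵒᵖ C] (P : Type*)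
    [AddCommGroup P] [Module S P] :
    BalancedTensor R S C (CharacterModule (CharacterModule P)) ≃ₗ[R]
      CharacterModule (CharacterModule (BalancedTensor R S C P)) :=
  let e : _ ≃+ CharacterModule (CharacterModule (BalancedTensor R S C P)) :=
    (AddEquiv.ofBijective _ ⟨homEval_injective R S C _, homEval_surjective R S C _⟩).trans
      ((characterEquiv R S C P).addMonoidHomCongrLeft (N := AddCircle (1 : ℚ)))
  { e with
    map_smul' := fun r t => by
      change e (r • t) = r • e t
      induction t using BalancedTensor.induction_on with
      | zero => simp only [smul_zero, map_zero]
      | tmul c φ => rfl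
      | add x y hx hy => simp only [smul_add, map_add, hx, hy] }

section Pi

variable {J : Type*} (P : J → Type*) [∀ j, AddCommGroup (P j)] [∀ j, Module S (P j)]

variable (R S C) in
/-- The comparison map `C ⊗_S ∏ P j → ∏ C ⊗_S P j`. -/
noncomputable def tensorPi :
    BalancedTensor R S C (∀ j, P j) →ₗ[R] ∀ j, BalancedTensor R S C (P j) :=
  LinearMap.pi fun j => lTensor R C (LinearMap.proj j)

lemma tensorPi_apply (t : BalancedTensor R S C (∀ j, P j)) (j : J) :
    tensorPi R S C P t j = lTensor R C (LinearMap.proj j) t := rfl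

variable [Module.FinitePresentation Sᵐᵒᵖ C]

variable (R S C) in
lemma tensorPi_injective : Function.Injective (tensorPi R S C P) := by
  rw [injective_iff_map_eq_zero]
  intro t ht
  obtain ⟨n, m, x, κ, hx, hκ⟩ := exists_finite_presentation Sᵐᵒᵖ C
  obtain ⟨p, rfl⟩ := exists_eq_sum_tmul_of_span_eq_top hx t
  have hp : ∀ j, ∃ q : Fin m → P j, ∀ i, p i j = ∑ l, (κ l i).unop • q l := fun j => by
    have hj : finsuppTmul R S (P j) x (Finsupp.equivFunOnFinite.symm fun i => p i j) = 0 := by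
      rw [finsuppTmul_apply]
      simpa [tensorPi_apply] using congrFun ht j
    obtain ⟨q, hq⟩ := exists_columnMap_eq hx hκ.ge hj
    exact ⟨q, fun i => by rw [← columnMap_apply, hq]; rfl⟩
  choose q hq using hp
  refine VanishesTrivially.sum_tmul_eq_zero ⟨m, fun l => κ l, fun l j => q j l, fun l => ?_,
    fun i => funext fun j => ?_⟩
  · rw [← linearCombination_eq_sum]
    exact hκ.le (Submodule.subset_span ⟨l, rfl⟩)
  · simpa using hq j i

variable (R S C) in
lemma tensorPi_surjective : Function.Surjective (tensorPi R S C P) := by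
  intro t
  obtain ⟨n, x, hx⟩ := Submodule.fg_iff_exists_fin_generating_family.1
    (Module.Finite.fg_top (R := Sᵐᵒᵖ) (M := C))
  choose p hp using fun j => exists_eq_sum_tmul_of_span_eq_top hx (t j)
  refine ⟨∑ i, tmul R S (x i) fun j => p j i, funext fun j => ?_⟩
  rw [hp j, map_sum, Finset.sum_apply]
  rfl

end Pi

end FinitePresentation

section Coherent

variable {S : Type u} [Ring S]

theorem IsRightCoherent.isFlat_pi (hS : IsRightCoherent S) {J : Type u} {P : J → Type u}
    [∀ j, AddCommGroup (P j)] [∀ j, Module S (P j)] (hP : ∀ j, IsFlat S (P j)) :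
    IsFlat S (∀ j, P j) := by
  refine isFlat_of_forall_fg_ideal fun I hI => ?_
  have : Module.FinitePresentation Sᵐᵒᵖ I := hS I hI
  intro t t' htt'
  refine tensorPi_injective ℤ S I P (funext fun j => hP j I S _ I.injective_subtype ?_)
  rw [tensorPi_apply, tensorPi_apply, ← lTensor_balancedTensorMap, htt',
    lTensor_balancedTensorMap]

theorem IsRightCoherent.isFlat_characterModule (hS : IsRightCoherent S) {E : Type u}
    [AddCommGroup E] [Module Sᵐᵒᵖ E] (hE : Module.Injective Sᵐᵒᵖ E) :
    IsFlat S (CharacterModule E) := by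
  refine isFlat_of_forall_fg_ideal fun I hI => ?_
  have : Module.FinitePresentation Sᵐᵒᵖ I := hS I hI
  intro t t' htt'
  refine homEval_injective ℤ S I E (CharacterModule.ext _ fun f => ?_)
  obtain ⟨g, hg⟩ := hE.out I.subtype I.injective_subtype f
  obtain rfl : g ∘ₗ I.subtype = f := LinearMap.ext hg
  rw [← homEval_balancedTensorMap, htt', homEval_balancedTensorMap]

lemma IsRightCoherent.isFlat_doubleDual (hS : IsRightCoherent S) {P : Type u} [AddCommGroup P]
    [Module S P] (hP : IsFlat S P) : IsFlat S (CharacterModule (CharacterModule P)) :=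
  hS.isFlat_characterModule (isFlat_iff_injective.1 hP)

end Coherent

section Lifting

lemma exists_common_eq_sum_tmul {R S C P ι : Type*} [Ring R] [Ring S] [AddCommGroup C]
    [Module R C] [Module Sᵐᵒᵖ C] [AddCommGroup P] [Module S P] [Finite ι]
    (t : ι → BalancedTensor R S C P) :
    ∃ (n : ℕ) (c : Fin n → ι → C) (p : Fin n → P), ∀ i, t i = ∑ k, tmul R S (c k i) (p k) := by
  classical
  cases nonempty_fintype ι
  choose N c p ht using fun i => exists_eq_sum_tmul (t i)
  let e := (Fintype.equivFin (Σ i, Fin (N i))).symm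
  refine ⟨_, fun k => Pi.single (e k).1 (c _ (e k).2), fun k => p _ (e k).2, fun i => ?_⟩
  refine Eq.trans ?_ (e.sum_comp fun k => tmul R S
    ((Pi.single k.1 (c k.1 k.2) : ι → C) i) (p k.1 k.2)).symm
  rw [Fintype.sum_sigma, Fintype.sum_eq_single i fun j hj => by simp [Pi.single_eq_of_ne' hj], ht i]
  simp only [Pi.single_eq_same]

variable {R S C P : Type u} [Ring R] [Ring S] [AddCommGroup C] [Module R C] [Module Sᵐᵒᵖ C]
  [SMulCommClass R Sᵐᵒᵖ C] [AddCommGroup P] [Module S P]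

lemma IsFlat.vanishesTrivially_pi (hP : IsFlat S P) {ι β : Type} [Fintype ι] [Finite β]
    {x : ι → β → C} {p : ι → P} (h : ∀ j, ∑ i, tmul R S (x i j) (p i) = 0) :
    VanishesTrivially S x p := by
  classical
  cases nonempty_fintype β
  refine hP.vanishesTrivially (R := ℤ) ?_
  calc ∑ i, tmul ℤ S (x i) (p i)
      = ∑ i, ∑ j, tmul ℤ S (Pi.single j (x i j)) (p i) :=
        Finset.sum_congr rfl fun i _ => by rw [← sum_tmul, Finset.univ_sum_single]
    _ = ∑ j, balancedTensorMap (LinearMap.single Sᵐᵒᵖ (fun _ => C) j) P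
          (BalancedTensor.forget R S (∑ i, tmul R S (x i j) (p i))) := by
        rw [Finset.sum_comm]
        simp
    _ = 0 := by simp [h]

theorem IsFlat.exists_eq_sum_tmulRight_comp {L : Type*} [AddCommGroup L] [Module R L]
    [Module.FinitePresentation R L] (hP : IsFlat S P) (g : L →ₗ[R] BalancedTensor R S C P) :
    ∃ (m : ℕ) (f : Fin m → L →ₗ[R] C) (q : Fin m → P),
      g = ∑ l, tmulRight R S C (q l) ∘ₗ f l := by
  obtain ⟨n, b, x, κ, hx, hκ⟩ := exists_finite_presentation R L
  obtain ⟨N, c, p, hcp⟩ := exists_common_eq_sum_tmul fun i => g (x i)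
  have hrel : ∀ j, ∑ k, tmul R S (Finsupp.linearCombination R (c k) (κ j)) (p k) = 0 := fun j => by
    have hj : Finsupp.linearCombination R x (κ j) = 0 :=
      hκ.le (Submodule.subset_span ⟨j, rfl⟩)
    calc _ = Finsupp.linearCombination R (fun i => g (x i)) (κ j) := by
          simp only [linearCombination_eq_sum, hcp, Finset.smul_sum, sum_tmul, smul_tmul']
          exact Finset.sum_comm
      _ = 0 := (Finsupp.apply_linearCombination R g x (κ j)).symm.trans (by rw [hj, map_zero])
  obtain ⟨m, v, q, hv, hq⟩ := hP.vanishesTrivially_pi hrel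
  have hf : ∀ l, ∃ f : L →ₗ[R] C, ∀ i, f (x i) = ∑ k, v l k • c k i := fun l => by
    refine exists_linearMap_of_relations hx hκ.ge fun j => (Eq.trans ?_ (congrFun (hv l) j))
    simp only [linearCombination_eq_sum, Finset.sum_apply, Pi.smul_apply, Finset.smul_sum,
      smul_comm (_ : R)]
    exact Finset.sum_comm
  choose f hf using hf
  refine ⟨m, f, q, LinearMap.ext_on_range hx fun i => ?_⟩
  simp only [hcp, hq, LinearMap.sum_apply, LinearMap.comp_apply, tmulRight_apply, hf, sum_tmul,
    tmul_sum, smul_tmul]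
  exact Finset.sum_comm

lemma IsFlat.exists_lift {F Q : Type u} {L : Type*} [AddCommGroup F] [Module S F] [AddCommGroup Q]
    [Module S Q] [AddCommGroup L] [Module R L] [Module.FinitePresentation R L] (hQ : IsFlat S Q)
    {g : F →ₗ[S] Q} (hg : Function.Surjective g) (k : L →ₗ[R] BalancedTensor R S C Q) :
    ∃ h : L →ₗ[R] BalancedTensor R S C F, lTensor R C g ∘ₗ h = k := by
  obtain ⟨m, f, q, rfl⟩ := hQ.exists_eq_sum_tmulRight_comp k
  choose p hp using fun l => hg (q l)
  exact ⟨∑ l, tmulRight R S C (p l) ∘ₗ f l, LinearMap.ext fun x => by simp [hp]⟩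

end Lifting

/-! ### Pure injective modules -/

section PureInjective

variable {R : Type u} [Ring R]

lemma IsPureShortExact.exists_solution {E : ShortComplex (ModuleCat.{u} R)}
    (hE : IsPureShortExact E) {ι : Type*} {m : ℕ} {κ : ι → Fin m → R} (hκ : (Set.range κ).Finite)
    {p : ι → E.X₁} {q : Fin m → E.X₂} (h : ∀ i, E.f (p i) = ∑ l, κ i l • q l) :
    ∃ a : Fin m → E.X₁, ∀ i, p i = ∑ l, κ i l • a l := by
  let K := Submodule.span R (Set.range κ)
  have hfp : Module.FinitePresentation R ((Fin m → R) ⧸ K) :=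
    Module.finitePresentation_of_surjective K.mkQ K.mkQ_surjective
      (K.ker_mkQ.symm ▸ Submodule.fg_span hκ)
  let k : (Fin m → R) →ₗ[R] E.X₂ := Fintype.linearCombination R q
  have hk : ∀ i, k (κ i) = E.f (p i) := fun i => (h i).symm
  have hK : K ≤ LinearMap.ker (E.g.hom ∘ₗ k) := Submodule.span_le.2 <| by
    rintro _ ⟨i, rfl⟩
    exact (congrArg E.g (hk i)).trans (E.moduleCat_zero_apply (p i))
  obtain ⟨φ, hφ⟩ := hE.2 (ModuleCat.of R ((Fin m → R) ⧸ K)) hfp (ModuleCat.ofHom (K.liftQ _ hK))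
  -- Subtracting the lift `φ` from the solution `q` produces a solution in the kernel of `E.g`.
  let ψ : (Fin m → R) →ₗ[R] E.X₂ := k - φ.hom ∘ₗ K.mkQ
  have hgψ : ∀ v, E.g (ψ v) = 0 := fun v => by
    have hv : E.g (φ (K.mkQ v)) = E.g (k v) :=
      LinearMap.congr_fun (congrArg ModuleCat.Hom.hom hφ) (K.mkQ v)
    exact (map_sub E.g.hom _ _).trans (sub_eq_zero.2 hv.symm)
  have hψ : ∀ i, ψ (κ i) = E.f (p i) := fun i => by
    have hi : K.mkQ (κ i) = 0 :=
      (Submodule.Quotient.mk_eq_zero K).2 (Submodule.subset_span ⟨i, rfl⟩)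
    rw [LinearMap.sub_apply, LinearMap.comp_apply, hi, map_zero, sub_zero, hk]
  choose a ha using fun l =>
    (ShortComplex.moduleCat_exact_iff E).1 hE.1.exact _ (hgψ (Pi.single l 1))
  refine ⟨a, fun i => hE.1.moduleCat_injective_f ?_⟩
  change E.f.hom (p i) = E.f.hom (∑ l, κ i l • a l)
  rw [map_sum]
  simp only [map_smul, ha]
  exact (hψ i).symm.trans <| by
    simpa [← Pi.single_apply, Pi.single_comm] using LinearMap.pi_apply_eq_sum_univ ψ (κ i)

theorem IsPureShortExact.lTensor_injective {E : ShortComplex (ModuleCat.{u} R)}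
    (hE : IsPureShortExact E) {T X : Type*} [Ring T] [AddCommGroup X] [Module T X] [Module Rᵐᵒᵖ X]
    [SMulCommClass T Rᵐᵒᵖ X] : Function.Injective (lTensor (S := R) T X E.f.hom) := by
  rw [injective_iff_map_eq_zero]
  intro t ht
  have hX : Submodule.span Rᵐᵒᵖ (Set.range (id : X → X)) = ⊤ := by simp
  obtain ⟨p, rfl⟩ := finsuppTmul_surjective hX t
  rw [lTensor_finsuppTmul] at ht
  obtain ⟨m, κ, q, hκ, hq⟩ := exists_relations_of_finsuppTmul_eq_zero hX ht
  have hfin : (Set.range fun x l => (κ l x).unop).Finite :=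
    (Set.Finite.pi' fun l => ((κ l).finite_range.image MulOpposite.unop)).subset <| by
      rintro _ ⟨x, rfl⟩ l
      exact ⟨_, ⟨x, rfl⟩, rfl⟩
  obtain ⟨a, ha⟩ := hE.exists_solution hfin hq
  convert finsuppTmul_columnMap hκ (Finsupp.equivFunOnFinite.symm a) using 2
  exact Finsupp.ext fun x =>
    (ha x).trans (columnMap_apply κ (Finsupp.equivFunOnFinite.symm a) x).symm

theorem pureInjective_characterModule (X : Type u) [AddCommGroup X] [Module Rᵐᵒᵖ X] :
    pureInjective R (ModuleCat.of R (CharacterModule X)) := by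
  intro E hE g
  let χ : CharacterModule (BalancedTensor ℤ R X E.X₁) := BalancedTensor.lift ℤ
    (AddMonoidHom.flip (g.hom.toAddMonoidHom : E.X₁ →+ X →+ AddCircle (1 : ℚ)))
    fun s x a => (DFunLike.congr_fun (map_smul g.hom s.unop a) x).symm
  obtain ⟨ψ, hψ⟩ := CharacterModule.dual_surjective_of_injective _
    (hE.lTensor_injective (T := ℤ) (X := X)) χ
  let h : E.X₂ →ₗ[R] CharacterModule X :=
    { toFun := fun b => AddMonoidHom.mk' (fun x => ψ (tmul ℤ R x b)) fun x y =>
        (congrArg ψ (add_tmul ℤ R x y b)).trans (map_add ψ _ _)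
      map_add' := fun b b' => CharacterModule.ext _ fun x =>
        (congrArg ψ (tmul_add ℤ R x b b')).trans (map_add ψ _ _)
      map_smul' := fun r b => CharacterModule.ext _ fun x =>
        congrArg ψ (smul_tmul ℤ R (MulOpposite.op r) x b).symm }
  exact ⟨ModuleCat.ofHom h, ModuleCat.hom_ext (LinearMap.ext fun a => CharacterModule.ext _ fun x =>
    DFunLike.congr_fun hψ (tmul ℤ R x a))⟩

lemma pureInjective_of_retract {M N : ModuleCat.{u} R} (hN : pureInjective R N) (i : M ⟶ N)
    (r : N ⟶ M) (h : i ≫ r = 𝟙 M) : pureInjective R M := by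
  intro E hE g
  obtain ⟨k, hk⟩ := hN E hE (g ≫ i)
  exact ⟨k ≫ r, by rw [← Category.assoc, hk, Category.assoc, h, Category.comp_id]⟩

lemma pureInjective_of_linearEquiv {M N : Type u} [AddCommGroup M] [Module R M] [AddCommGroup N]
    [Module R N] (e : M ≃ₗ[R] N) (hN : pureInjective R (ModuleCat.of R N)) :
    pureInjective R (ModuleCat.of R M) :=
  pureInjective_of_retract hN (ModuleCat.ofHom e.toLinearMap) (ModuleCat.ofHom e.symm.toLinearMap)
    (ModuleCat.hom_ext (LinearMap.ext fun x => e.symm_apply_apply x))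

end PureInjective

/-! ### `C`-flat modules -/

lemma cFlat_tensor {R S C P : Type u} [Ring R] [Ring S] [AddCommGroup C] [Module R C]
    [Module Sᵐᵒᵖ C] [AddCommGroup P] [Module S P] (hP : IsFlat S P) :
    cFlat R S C (ModuleCat.of R (BalancedTensor R S C P)) :=
  ⟨ModuleCat.of S P, hP, ⟨LinearEquiv.refl _ _⟩⟩

section PureSequences

variable {R S C : Type u} [Ring R] [Ring S] [AddCommGroup C] [Module R C]
  [Module Sᵐᵒᵖ C] [SMulCommClass R Sᵐᵒᵖ C]

lemma moduleCatMk_shortExact {A B D : Type u} [AddCommGroup A] [Module R A] [AddCommGroup B]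
    [Module R B] [AddCommGroup D] [Module R D] {f : A →ₗ[R] B} {g : B →ₗ[R] D}
    (hf : Function.Injective f) (hg : Function.Surjective g) (hex : Function.Exact f g) :
    (ShortComplex.moduleCatMk f g hex.linearMap_comp_eq_zero).ShortExact where
  exact := (ShortComplex.ShortExact.moduleCat_exact_iff_function_exact _).2 hex
  mono_f := (ModuleCat.mono_iff_injective _).2 hf
  epi_g := (ModuleCat.epi_iff_surjective _).2 hg

section

variable {K F Q : Type u} [AddCommGroup K] [Module S K] [AddCommGroup F] [Module S F]
  [AddCommGroup Q] [Module S Q] {i : K →ₗ[S] F} {g : F →ₗ[S] Q}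

variable (R C) in
/-- The complex `C ⊗_S K ⟶ C ⊗_S F ⟶ C ⊗_S Q` obtained by tensoring `C` with a right exact sequence
`K ⟶ F ⟶ Q ⟶ 0`. -/
noncomputable def tensorComplex (hg : Function.Surjective g) (hex : Function.Exact i g) :
    ShortComplex (ModuleCat.{u} R) :=
  ShortComplex.moduleCatMk (lTensor R C i) (lTensor R C g)
    (lTensor_exact hg hex).linearMap_comp_eq_zero

theorem IsFlat.isPureShortExact_tensorComplex (hQ : IsFlat S Q) (hi : Function.Injective i)
    (hg : Function.Surjective g) (hex : Function.Exact i g) :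
    IsPureShortExact (tensorComplex R C hg hex) := by
  refine ⟨moduleCatMk_shortExact (hQ.lTensor_injective hi hg hex) (lTensor_surjective hg)
    (lTensor_exact hg hex), fun M _ k => ?_⟩
  obtain ⟨h, hh⟩ := hQ.exists_lift hg k.hom
  exact ⟨ModuleCat.ofHom h, ModuleCat.hom_ext hh⟩

end

section DoubleDual

variable {P : Type u} [AddCommGroup P] [Module S P]

theorem pureInjective_tensor_doubleDual [Module.FinitePresentation Sᵐᵒᵖ C] :
    pureInjective R (ModuleCat.of R (BalancedTensor R S C (CharacterModule (CharacterModule P)))) :=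
  pureInjective_of_linearEquiv (tensorDoubleDualEquiv R S C P) (pureInjective_characterModule _)

lemma isPureShortExact_tensor_doubleDualEval
    (h : IsFlat S (CharacterModule (CharacterModule P))) :
    IsPureShortExact (tensorComplex R C (Submodule.mkQ_surjective _)
      (LinearMap.exact_map_mkQ_range (doubleDualEval S P))) :=
  (isFlat_doubleDual_quotient h).isPureShortExact_tensorComplex doubleDualEval_injective _ _

end DoubleDual

theorem isCogeneratorFor_cFlat [Module.FinitePresentation Sᵐᵒᵖ C] (hS : IsRightCoherent S) :
    IsCogeneratorFor (cFlat R S C ⊓ pureInjective R) (cFlat R S C) := by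
  refine ⟨inf_le_left, ?_⟩
  rintro X ⟨P, hP, ⟨e⟩⟩
  have hPP := hS.isFlat_doubleDual hP
  have hseq : (tensorComplex R C _ _).ShortExact := (isPureShortExact_tensor_doubleDualEval hPP).1
  have hX := moduleCatMk_shortExact
    (f := lTensor R C (doubleDualEval S P) ∘ₗ e.toLinearMap)
    (g := lTensor R C (LinearMap.range (doubleDualEval S P)).mkQ)
    (hseq.moduleCat_injective_f.comp e.injective) hseq.moduleCat_surjective_g <| by
      refine (e.surjective.comp_exact_iff_exact).2 ?_
      exact (ShortComplex.ShortExact.moduleCat_exact_iff_function_exact _).1 hseq.exact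
  exact ⟨_, _, _, _, _, hX, ⟨cFlat_tensor hPP, pureInjective_tensor_doubleDual⟩,
    cFlat_tensor (isFlat_doubleDual_quotient hPP)⟩

end PureSequences

/-! ### Vanishing of `Ext` -/

section Ext

variable {A : Type*} [Category A] [Abelian A] [HasExt.{u} A] {E : ShortComplex A} {X X' Y Y' : A}

lemma subsingleton_ext_of_iso_left (e : X ≅ X') {n : ℕ} (h : Subsingleton (Ext.{u} X Y n)) :
    Subsingleton (Ext.{u} X' Y n) :=
  let e' : Ext X' Y n ≃+ Ext X Y n :=
    (((extFunctor n).mapIso e.op).app Y).addCommGroupIsoToAddEquiv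
  e'.toEquiv.subsingleton_congr.2 h

lemma subsingleton_ext_of_iso_right (e : Y ≅ Y') {n : ℕ} (h : Subsingleton (Ext.{u} X Y n)) :
    Subsingleton (Ext.{u} X Y' n) :=
  let e' : Ext X Y n ≃+ Ext X Y' n := ((extFunctorObj X n).mapIso e).addCommGroupIsoToAddEquiv
  e'.toEquiv.subsingleton_congr.1 h

lemma subsingleton_ext_X₃ (hE : E.ShortExact) {n : ℕ} (h₁ : Subsingleton (Ext.{u} E.X₁ Y n))
    (h₂ : Subsingleton (Ext.{u} E.X₂ Y (n + 1))) : Subsingleton (Ext.{u} E.X₃ Y (n + 1)) := by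
  refine subsingleton_of_forall_eq 0 fun x => ?_
  obtain ⟨y, rfl⟩ := Ext.contravariant_sequence_exact₃ hE Y x (Subsingleton.elim _ _)
    (add_comm 1 n)
  rw [Subsingleton.elim y 0, Ext.comp_zero]

lemma subsingleton_ext_X₁ (hE : E.ShortExact) {n : ℕ} (h₂ : Subsingleton (Ext.{u} E.X₂ Y n))
    (h₃ : Subsingleton (Ext.{u} E.X₃ Y (n + 1))) : Subsingleton (Ext.{u} E.X₁ Y n) := by
  refine subsingleton_of_forall_eq 0 fun x => ?_
  obtain ⟨y, rfl⟩ := Ext.contravariant_sequence_exact₁ hE Y x (add_comm 1 n)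
    (Subsingleton.elim _ _)
  rw [Subsingleton.elim y 0, Ext.comp_zero]

lemma subsingleton_ext_one_X₃ (hE : E.ShortExact) (h₂ : Subsingleton (Ext.{u} E.X₂ Y 1))
    (h : ∀ f : E.X₁ ⟶ Y, ∃ k : E.X₂ ⟶ Y, E.f ≫ k = f) : Subsingleton (Ext.{u} E.X₃ Y 1) := by
  refine subsingleton_of_forall_eq 0 fun x => ?_
  obtain ⟨y, rfl⟩ := Ext.contravariant_sequence_exact₃ hE Y x (Subsingleton.elim _ _)
    (add_zero 1)
  obtain ⟨f, rfl⟩ := (Ext.mk₀_bijective _ _).2 y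
  obtain ⟨k, rfl⟩ := h f
  rw [← Ext.mk₀_comp_mk₀]
  exact hE.extClass_comp_assoc _

lemma exists_comp_eq_of_subsingleton_ext (hE : E.ShortExact)
    (h : Subsingleton (Ext.{u} E.X₃ Y 1)) (f : E.X₁ ⟶ Y) : ∃ k : E.X₂ ⟶ Y, E.f ≫ k = f := by
  obtain ⟨y, hy⟩ := Ext.contravariant_sequence_exact₁ hE Y (Ext.mk₀.{u} f) (add_zero 1)
    (Subsingleton.elim _ _)
  obtain ⟨k, rfl⟩ := (Ext.mk₀_bijective _ _).2 y
  exact ⟨k, (Ext.mk₀_bijective _ _).1 (by rw [← hy, ← Ext.mk₀_comp_mk₀])⟩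

end Ext

section ExtFinsupp

variable {R : Type u} [Ring R] {E : ShortComplex (ModuleCat.{u} R)} {Y : ModuleCat.{u} R}

lemma exists_linearMap_comp_eq_of_subsingleton_ext (hE : E.ShortExact)
    (h : Subsingleton (Ext E.X₃ Y 1)) (f : E.X₁ →ₗ[R] Y) :
    ∃ k : E.X₂ →ₗ[R] Y, k ∘ₗ E.f.hom = f := by
  obtain ⟨k, hk⟩ := exists_comp_eq_of_subsingleton_ext hE h (ModuleCat.ofHom f)
  exact ⟨k.hom, congrArg ModuleCat.Hom.hom hk⟩

lemma shortExact_finsupp (hE : E.ShortExact) (ι : Type u) :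
    (ShortComplex.moduleCatMk (Finsupp.mapRange.linearMap (α := ι) E.f.hom)
      (Finsupp.mapRange.linearMap (α := ι) E.g.hom) (LinearMap.ext fun x => Finsupp.ext fun i =>
        E.moduleCat_zero_apply (x i))).ShortExact := by
  refine moduleCatMk_shortExact
    (Finsupp.mapRange_injective _ (map_zero _) hE.moduleCat_injective_f)
    (Finsupp.mapRange_surjective _ (map_zero _) hE.moduleCat_surjective_g) ?_
  have hex := (ShortComplex.ShortExact.moduleCat_exact_iff_function_exact E).1 hE.exact
  rw [LinearMap.exact_iff, Finsupp.ker_mapRange, Finsupp.range_mapRange_linearMap _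
    (LinearMap.ker_eq_bot.2 hE.moduleCat_injective_f), LinearMap.exact_iff.1 hex]

lemma subsingleton_ext_finsupp_of_projective (ι : Type u) (n : ℕ) (L : ModuleCat.{u} R)
    [Module.Projective R L] : Subsingleton (Ext (ModuleCat.of R (ι →₀ L)) Y (n + 1)) := by
  classical
  have : Module.Projective R (ι →₀ L) := .of_equiv (finsuppLequivDFinsupp R).symm
  have : Projective (ModuleCat.of R (ι →₀ L)) :=
    (ModuleCat.of R _).projective_of_categoryTheory_projective
  exact Ext.subsingleton_of_projective _ _ _

theorem subsingleton_ext_finsupp (ι : Type u) (n : ℕ) (L : ModuleCat.{u} R)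
    (hL : ∀ k, Subsingleton (Ext L Y (k + 1))) :
    Subsingleton (Ext (ModuleCat.of R (ι →₀ L)) Y (n + 1)) := by
  induction n generalizing L with
  | zero =>
    have hE := ModuleCat.shortExact_projectiveShortComplex L
    refine subsingleton_ext_one_X₃ (shortExact_finsupp hE ι)
      (subsingleton_ext_finsupp_of_projective ι 0 L.projectiveShortComplex.X₂) fun f => ?_
    choose k hk using fun i => exists_linearMap_comp_eq_of_subsingleton_ext hE (hL 0)
      (f.hom ∘ₗ Finsupp.lsingle i)
    refine ⟨ModuleCat.ofHom (Finsupp.lsum ℕ k), ModuleCat.hom_ext <| Finsupp.lhom_ext fun i x => ?_⟩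
    refine Eq.trans ?_ (LinearMap.congr_fun (hk i) x)
    change Finsupp.lsum ℕ k (Finsupp.mapRange.linearMap _ (Finsupp.single i x)) = _
    rw [Finsupp.mapRange.linearMap_apply, Finsupp.mapRange_single, Finsupp.lsum_single]
    rfl
  | succ n ih =>
    have hE := ModuleCat.shortExact_projectiveShortComplex L
    refine subsingleton_ext_X₃ (shortExact_finsupp hE ι) (ih _ fun k => ?_)
      (subsingleton_ext_finsupp_of_projective ι (n + 1) L.projectiveShortComplex.X₂)
    exact subsingleton_ext_X₁ hE (Ext.subsingleton_of_projective _ _ _) (hL (k + 1))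

end ExtFinsupp

section Syzygies

variable {R : Type u} [Ring R]

/-- `L` is a sequence of syzygies of the module `L 0`: each `L (n + 1)` is the kernel of a
surjection from a projective module onto `L n`. -/
def IsSyzygySequence (L : ℕ → ModuleCat.{u} R) : Prop :=
  ∀ n, ∃ (F : ModuleCat.{u} R) (f : L (n + 1) ⟶ F) (g : F ⟶ L n) (w : f ≫ g = 0),
    (ShortComplex.mk f g w).ShortExact ∧ Projective F

lemma exists_shortExact_quotient_range {K₂ K₁ K₀ : Type u} [AddCommGroup K₂] [Module R K₂]
    [AddCommGroup K₁] [Module R K₁] [AddCommGroup K₀] [Module R K₀] {d₂ : K₂ →ₗ[R] K₁}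
    {d₁ : K₁ →ₗ[R] K₀} (h : Function.Exact d₂ d₁) :
    ∃ (f : ModuleCat.of R (K₁ ⧸ LinearMap.range d₂) ⟶ ModuleCat.of R K₀)
      (g : ModuleCat.of R K₀ ⟶ ModuleCat.of R (K₀ ⧸ LinearMap.range d₁)) (w : f ≫ g = 0),
      (ShortComplex.mk f g w).ShortExact := by
  have hker := LinearMap.exact_iff.1 h
  refine ⟨_, _, _, moduleCatMk_shortExact (f := (LinearMap.range d₂).liftQ d₁ hker.ge)
    (g := (LinearMap.range d₁).mkQ) ?_ (Submodule.mkQ_surjective _) ?_⟩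
  · exact LinearMap.ker_eq_bot.1 (Submodule.ker_liftQ_eq_bot _ _ _ hker.le)
  · rw [LinearMap.exact_iff, Submodule.ker_mkQ, Submodule.range_liftQ]

theorem HasFiniteProjectiveResolution.exists_isSyzygySequence {M : Type u} [AddCommGroup M]
    [Module R M] (h : HasFiniteProjectiveResolution R M) :
    ∃ L : ℕ → ModuleCat.{u} R, IsSyzygySequence L ∧ (∀ n, Module.FinitePresentation R (L n)) ∧
      Nonempty (L 0 ≅ ModuleCat.of R M) := by
  obtain ⟨P, hP⟩ := h
  let d n : P.complex.X (n + 1) →ₗ[R] P.complex.X n := (P.complex.d (n + 1) n).hom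
  have hexact n : Function.Exact (d (n + 1)) (d n) :=
    (ShortComplex.ShortExact.moduleCat_exact_iff_function_exact _).1 (P.exact_succ n)
  refine ⟨fun n => ModuleCat.of R (P.complex.X n ⧸ LinearMap.range (d n)), fun n => ?_,
    fun n => ?_, ⟨?_⟩⟩
  · obtain ⟨f, g, w, hE⟩ := exists_shortExact_quotient_range (hexact n)
    exact ⟨_, f, g, w, hE, P.projective n⟩
  · have := P.projective n
    have : Module.Projective R (P.complex.X n) := ModuleCat.projective_of_module_projective _
    have := Module.finitePresentation_of_projective R (P.complex.X n)
    refine Module.finitePresentation_of_surjective (LinearMap.range (d n)).mkQ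
      (Submodule.mkQ_surjective _) ?_
    rw [Submodule.ker_mkQ]
    exact Module.Finite.iff_fg.1 inferInstance
  · exact (ModuleCat.cokernelIsColimit (P.complex.d 1 0)).coconePointUniqueUpToIso
      P.isColimitCokernelCofork ≪≫
        HomologicalComplex.singleObjXSelf (ComplexShape.down ℕ) 0 (ModuleCat.of R M)

lemma HasFiniteProjectiveResolution.finitePresentation {M : Type u} [AddCommGroup M] [Module R M]
    (h : HasFiniteProjectiveResolution R M) : Module.FinitePresentation R M := by
  obtain ⟨L, _, hL, ⟨e⟩⟩ := h.exists_isSyzygySequence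
  exact (hL 0).of_equiv e.toLinearEquiv

lemma IsSyzygySequence.subsingleton_ext {L : ℕ → ModuleCat.{u} R} (hL : IsSyzygySequence L)
    {Y : ModuleCat.{u} R} (h : ∀ k, Subsingleton (Ext (L 0) Y (k + 1))) (n k : ℕ) :
    Subsingleton (Ext (L n) Y (k + 1)) := by
  induction n generalizing k with
  | zero => exact h k
  | succ n ih =>
    obtain ⟨F, f, g, w, hE, _⟩ := hL n
    exact subsingleton_ext_X₁ hE (Ext.subsingleton_of_projective F Y k) (ih (k + 1))

end Syzygies

section CFlatExt

variable {R S C : Type u} [Ring R] [Ring S] [AddCommGroup C] [Module R C]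
  [Module Sᵐᵒᵖ C] [SMulCommClass R Sᵐᵒᵖ C]

lemma IsFlat.exists_comp_eq_of_subsingleton_ext {P : Type u} [AddCommGroup P] [Module S P]
    (hP : IsFlat S P) {E : ShortComplex (ModuleCat.{u} R)} (hE : E.ShortExact)
    [Module.FinitePresentation R E.X₁] (h : Subsingleton (Ext E.X₃ (ModuleCat.of R C) 1))
    (f : E.X₁ ⟶ ModuleCat.of R (BalancedTensor R S C P)) :
    ∃ k : E.X₂ ⟶ ModuleCat.of R (BalancedTensor R S C P), E.f ≫ k = f := by
  obtain ⟨m, a, q, hf⟩ := hP.exists_eq_sum_tmulRight_comp f.hom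
  choose b hb using fun l =>
    exists_linearMap_comp_eq_of_subsingleton_ext (Y := ModuleCat.of R C) hE h (a l)
  refine ⟨ModuleCat.ofHom (∑ l, tmulRight R S C (q l) ∘ₗ b l), ModuleCat.hom_ext ?_⟩
  rw [hf]
  refine LinearMap.ext fun x => ?_
  simp [← hb]

theorem IsFlat.subsingleton_ext_tensor {M P : Type u} [AddCommGroup M] [Module R M]
    [AddCommGroup P] [Module S P] (hP : IsFlat S P) (hM : HasFiniteProjectiveResolution R M)
    (hext : ∀ k, Subsingleton (Ext (ModuleCat.of R M) (ModuleCat.of R C) (k + 1))) (k : ℕ) :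
    Subsingleton (Ext (ModuleCat.of R M) (ModuleCat.of R (BalancedTensor R S C P)) (k + 1)) := by
  obtain ⟨L, hL, hfp, ⟨e⟩⟩ := hM.exists_isSyzygySequence
  have hLC := hL.subsingleton_ext fun k => subsingleton_ext_of_iso_left e.symm (hext k)
  suffices h : ∀ n, Subsingleton
      (Ext (L n) (ModuleCat.of R (BalancedTensor R S C P)) (k + 1)) from
    subsingleton_ext_of_iso_left e (h 0)
  induction k with
  | zero =>
    intro n
    obtain ⟨F, f, g, w, hE, _⟩ := hL n
    have := hfp (n + 1)
    exact subsingleton_ext_one_X₃ hE (Ext.subsingleton_of_projective F _ 0)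
      (hP.exists_comp_eq_of_subsingleton_ext hE (hLC n 0))
  | succ k ih =>
    intro n
    obtain ⟨F, f, g, w, hE, _⟩ := hL n
    exact subsingleton_ext_X₃ hE (ih (n + 1)) (Ext.subsingleton_of_projective F _ (k + 1))

theorem IsFlat.subsingleton_ext_of_pureInjective {M : ModuleCat.{u} R} (hM : pureInjective R M)
    (hext : ∀ k, Subsingleton (Ext (ModuleCat.of R C) M (k + 1))) (k : ℕ) {Q : Type u}
    [AddCommGroup Q] [Module S Q] (hQ : IsFlat S Q) :
    Subsingleton (Ext (ModuleCat.of R (BalancedTensor R S C Q)) M (k + 1)) := by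
  have hfree (ι : Type u) (k : ℕ) :
      Subsingleton (Ext (ModuleCat.of R (BalancedTensor R S C (ι →₀ S))) M (k + 1)) :=
    subsingleton_ext_of_iso_left (finsuppEquiv R S C ι).symm.toModuleIso
      (subsingleton_ext_finsupp ι k (ModuleCat.of R C) hext)
  induction k generalizing Q with
  | zero =>
    have hpure := hQ.isPureShortExact_tensorComplex (R := R) (C := C)
      (Submodule.injective_subtype _) (Finsupp.linearCombination_id_surjective S Q)
      (LinearMap.exact_subtype_ker_map _)
    exact subsingleton_ext_one_X₃ hpure.1 (hfree Q 0) (hM _ hpure)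
  | succ k ih =>
    have hg := Finsupp.linearCombination_id_surjective S Q
    have hex := LinearMap.exact_subtype_ker_map (Finsupp.linearCombination S (id : Q → Q))
    have hpure := hQ.isPureShortExact_tensorComplex (R := R) (C := C)
      (Submodule.injective_subtype _) hg hex
    have hK := hQ.kernel (isFlat_finsupp Q) (Submodule.injective_subtype _) hg hex
    exact subsingleton_ext_X₃ hpure.1 (ih hK) (hfree Q (k + 1))

theorem extOrthogonal_cFlat (hC : HasFiniteProjectiveResolution R C)
    (hext : ∀ i, 1 ≤ i → Subsingleton (Ext (ModuleCat.of R C) (ModuleCat.of R C) i)) :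
    ExtOrthogonal (cFlat R S C) (cFlat R S C ⊓ pureInjective R) := by
  rintro X Y ⟨Q, hQ, ⟨e⟩⟩ ⟨⟨P, hP, ⟨e'⟩⟩, hY⟩ i hi
  obtain ⟨k, rfl⟩ := Nat.exists_eq_add_of_le' hi
  have hCY (n : ℕ) : Subsingleton (Ext (ModuleCat.of R C) Y (n + 1)) :=
    subsingleton_ext_of_iso_right e'.symm.toModuleIso
      (hP.subsingleton_ext_tensor hC (fun n => hext (n + 1) n.succ_pos) n)
  exact subsingleton_ext_of_iso_left e.symm.toModuleIso
    (IsFlat.subsingleton_ext_of_pureInjective hY hCY k hQ)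

end CFlatExt

/-! ### Small flat modules and preenvelopes -/

section SmallFlat

variable {R S C P P₀ : Type*} [Ring R] [Ring S] [AddCommGroup C] [Module R C] [Module Sᵐᵒᵖ C]
  [SMulCommClass R Sᵐᵒᵖ C] [AddCommGroup P] [Module S P] [AddCommGroup P₀] [Module S P₀]

lemma VanishesTrivially.sum_smul {N ι β : Type*} [AddCommGroup N] [Module Sᵐᵒᵖ N] [Fintype ι]
    [Fintype β] {c : ι → N} {y : β → P} {σ : ι → β → S}
    (h : VanishesTrivially S (fun a => ∑ i, MulOpposite.op (σ i a) • c i) y) :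
    VanishesTrivially S c fun i => ∑ a, σ i a • y a := by
  obtain ⟨m, κ, q, hκ, hy⟩ := h
  refine ⟨m, fun l i => ∑ a, κ l a * MulOpposite.op (σ i a), q, fun l => ?_, fun i => ?_⟩
  · simp only [Finset.sum_smul, mul_smul]
    rw [Finset.sum_comm]
    simp only [← Finset.smul_sum, hκ]
  · simp only [hy, Finset.smul_sum, Finset.unop_sum, Finset.sum_smul, MulOpposite.unop_mul,
      MulOpposite.unop_op, mul_smul]
    exact Finset.sum_comm

lemma exists_eq_sum_smul_of_span_eq_top {W ι : Type*} [Finite ι] {x : W → P}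
    (hx : Submodule.span S (Set.range x) = ⊤) (p : ι → P) :
    ∃ (n : ℕ) (w : Fin n → W) (σ : ι → Fin n → S), p = fun i => ∑ a, σ i a • x (w a) := by
  classical
  cases nonempty_fintype ι
  choose v hv using fun i =>
    Finsupp.mem_span_range_iff_exists_finsupp.1 (hx ▸ Submodule.mem_top (x := p i))
  let J := Finset.univ.biUnion fun i => (v i).support
  let e := J.equivFin
  refine ⟨J.card, fun a => e.symm a, fun i a => v i (e.symm a), funext fun i => ?_⟩
  rw [e.symm.sum_comp (fun j : J => v i j • x j), Finset.sum_coe_sort J fun j => v i j • x j, ← hv]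
  exact Finsupp.sum_of_support_subset _
    (Finset.subset_biUnion_of_mem (fun i => (v i).support) (Finset.mem_univ i)) _ (by simp)

/-- A relative form of purity: a sum of tensors with coefficients in the right module `N` that
vanishes after applying `j : P₀ → P` already vanishes trivially in `N ⊗_S P₀`. -/
def ReflectsVanishing (N : Type*) [AddCommGroup N] [Module Sᵐᵒᵖ N] (j : P₀ →ₗ[S] P) : Prop :=
  ∀ (n : ℕ) (c : Fin n → N) (p : Fin n → P₀),
    ∑ i, tmul ℤ S (c i) (j (p i)) = 0 → VanishesTrivially S c p

namespace ReflectsVanishing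

variable {N N' : Type*} [AddCommGroup N] [Module Sᵐᵒᵖ N] [AddCommGroup N'] [Module Sᵐᵒᵖ N']
  {j : P₀ →ₗ[S] P}

lemma of_injective {f : N →ₗ[Sᵐᵒᵖ] N'} (hf : Function.Injective f) (h : ReflectsVanishing N' j) :
    ReflectsVanishing N j := fun n c p hp =>
  .of_injective hf <| h n _ p <| by simpa using congrArg (balancedTensorMap f P) hp

lemma of_span_eq_top {W : Type*} {x : W → P₀} (hx : Submodule.span S (Set.range x) = ⊤)
    (h : ∀ (n : ℕ) (c : Fin n → N) (w : Fin n → W), ∑ i, tmul ℤ S (c i) (j (x (w i))) = 0 →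
      VanishesTrivially S c fun i => x (w i)) : ReflectsVanishing N j := by
  intro n c p hp
  obtain ⟨m, w, σ, rfl⟩ := exists_eq_sum_smul_of_span_eq_top hx p
  refine .sum_smul (h m _ w (Eq.trans ?_ hp))
  simp only [map_sum, map_smul, sum_tmul, tmul_sum, smul_tmul]
  exact Finset.sum_comm

lemma lTensor_injective (h : ReflectsVanishing C j) : Function.Injective (lTensor R C j) := by
  rw [injective_iff_map_eq_zero]
  intro t ht
  obtain ⟨n, c, p, rfl⟩ := exists_eq_sum_tmul t
  refine (h n c p ?_).sum_tmul_eq_zero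
  simpa using congrArg (BalancedTensor.forget R S) ht

end ReflectsVanishing

lemma ReflectsVanishing.isFlat {S P P₀ : Type u} [Ring S] [AddCommGroup P] [Module S P]
    [AddCommGroup P₀] [Module S P₀] {j : P₀ →ₗ[S] P} (h : ReflectsVanishing S j) :
    IsFlat S P₀ := by
  refine isFlat_of_vanishesTrivially fun n s p hp => h n s p ?_
  have hs (i : Fin n) : tmul ℤ S (s i) (j (p i)) = tmul ℤ S 1 (j (s i • p i)) := by
    rw [map_smul, tmul_eq_one_tmul ℤ S (s i)]
  simp only [hs, ← tmul_sum, ← map_sum, hp, map_zero, tmul_zero]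

/-- Formal generators for the closure of a family indexed by `B` under solutions of the vanishing
sums of tensors with coefficients in `N`: the generator `solution n c w l` stands for the `l`-th
element used to explain why `∑ i, c i ⊗ w i` vanishes. They bound the size of the closure. -/
inductive ClosureGenerator (B N : Type u) : Type u
  | base (b : B) : ClosureGenerator B N
  | solution (n : ℕ) (c : Fin n → N) (w : Fin n → ClosureGenerator B N) (l : ℕ) :
    ClosureGenerator B N

/-- The element of `P` named by a formal generator, given the base family `b` and a choice `q` of
solutions. -/
def ClosureGenerator.eval {B N P : Type u} (b : B → P)
    (q : ∀ n : ℕ, (Fin n → N) → (Fin n → P) → ℕ → P) : ClosureGenerator B N → P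
  | .base a => b a
  | .solution n c w l => q n c (fun k => (w k).eval b q) l

end SmallFlat

section Preenvelope

variable {R S C P : Type u} [Ring R] [Ring S] [AddCommGroup C] [Module R C] [Module Sᵐᵒᵖ C]
  [SMulCommClass R Sᵐᵒᵖ C] [AddCommGroup P] [Module S P]

lemma IsFlat.exists_solutions (hP : IsFlat S P) (N : Type u) [AddCommGroup N] [Module Sᵐᵒᵖ N] :
    ∃ q : ∀ n : ℕ, (Fin n → N) → (Fin n → P) → ℕ → P, ∀ n c p, ∑ i, tmul ℤ S (c i) (p i) = 0 →
      ∃ (m : ℕ) (κ : Fin m → Fin n → Sᵐᵒᵖ), (∀ l, ∑ i, κ l i • c i = 0) ∧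
        ∀ i, p i = ∑ l, (κ l i).unop • q n c p l := by
  have h (n : ℕ) (c : Fin n → N) (p : Fin n → P) : ∃ q : ℕ → P, ∑ i, tmul ℤ S (c i) (p i) = 0 →
      ∃ (m : ℕ) (κ : Fin m → Fin n → Sᵐᵒᵖ), (∀ l, ∑ i, κ l i • c i = 0) ∧
        ∀ i, p i = ∑ l, (κ l i).unop • q l := by
    by_cases h : ∑ i, tmul ℤ S (c i) (p i) = 0
    · obtain ⟨m, κ, q, hκ, hp⟩ := hP.vanishesTrivially h
      exact ⟨fun l => if hl : l < m then q ⟨l, hl⟩ else 0, fun _ => ⟨m, κ, hκ, by simpa using hp⟩⟩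
    · exact ⟨0, fun h' => absurd h' h⟩
  choose q hq using h
  exact ⟨q, hq⟩

theorem IsFlat.exists_reflectsVanishing (hP : IsFlat S P) (N : Type u) [AddCommGroup N]
    [Module Sᵐᵒᵖ N] {B : Type u} (b : B → P) :
    ∃ (K : Submodule S (ClosureGenerator B N →₀ S)) (j : (ClosureGenerator B N →₀ S) ⧸ K →ₗ[S] P),
      ReflectsVanishing N j ∧ ∀ a, b a ∈ LinearMap.range j := by
  obtain ⟨q, hq⟩ := hP.exists_solutions N
  let π := Finsupp.linearCombination S (ClosureGenerator.eval (N := N) b q)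
  let K := LinearMap.ker π
  let j := K.liftQ π le_rfl
  have hj : Function.Injective j := LinearMap.ker_eq_bot.1 (Submodule.ker_liftQ_eq_bot _ _ _ le_rfl)
  let x (w : ClosureGenerator B N) := K.mkQ (Finsupp.single w 1)
  have hjx (w : ClosureGenerator B N) : j (x w) = w.eval b q :=
    (Finsupp.linearCombination_single S 1 w).trans (one_smul S _)
  have hx : Submodule.span S (Set.range x) = ⊤ := by
    rw [show x = K.mkQ ∘ fun w => Finsupp.single w 1 from rfl, Set.range_comp, ← Submodule.map_span,
      ← Finsupp.coe_basisSingleOne, Module.Basis.span_eq, Submodule.map_top, Submodule.range_mkQ]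
  refine ⟨K, j, .of_span_eq_top hx fun n c w h => ?_, fun a => ⟨x (.base a), hjx _⟩⟩
  simp only [hjx] at h
  obtain ⟨m, κ, hκ, hw⟩ := hq n c _ h
  refine ⟨m, κ, fun l => x (.solution n c w l), hκ, fun i => hj ?_⟩
  simp only [map_sum, map_smul, hjx]
  exact hw i

/-- The free module of which `_ ⧸ K` is a quotient does not depend on `P`, so these quotients form a
set as `P` varies. -/
theorem IsFlat.exists_small_factor {A : Type u} [AddCommGroup A] [Module R A] (hP : IsFlat S P)
    (f : A →ₗ[R] BalancedTensor R S C P) :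
    ∃ K : Submodule S (ClosureGenerator (A × ℕ) (C × S) →₀ S), IsFlat S (_ ⧸ K) ∧
      ∃ (f₀ : A →ₗ[R] BalancedTensor R S C (_ ⧸ K)) (j : (_ ⧸ K) →ₗ[S] P),
        lTensor R C j ∘ₗ f₀ = f := by
  choose n c p hf using fun a => exists_eq_sum_tmul (f a)
  obtain ⟨K, j, hj, hp⟩ := hP.exists_reflectsVanishing (C × S)
    fun a : A × ℕ => if h : a.2 < n a.1 then p a.1 ⟨a.2, h⟩ else 0
  have hinj : Function.Injective (lTensor R C j) :=
    (hj.of_injective (f := LinearMap.inl Sᵐᵒᵖ C S) LinearMap.inl_injective).lTensor_injective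
  have hrange (a : A) : f a ∈ LinearMap.range (lTensor R C j) := by
    choose y hy using fun i : Fin (n a) => hp (a, i)
    refine ⟨∑ i, tmul R S (c a i) (y i), ?_⟩
    simp [hy, hf]
  let e := LinearEquiv.ofInjective _ hinj
  exact ⟨K, (hj.of_injective (f := LinearMap.inr Sᵐᵒᵖ C S) LinearMap.inr_injective).isFlat,
    e.symm.toLinearMap ∘ₗ f.codRestrict _ hrange, j,
    LinearMap.ext fun a => congrArg Subtype.val (e.apply_symm_apply ⟨f a, hrange a⟩)⟩

theorem IsRightCoherent.exists_isPreenvelope_of_family [Module.FinitePresentation Sᵐᵒᵖ C]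
    (hS : IsRightCoherent S) (A : ModuleCat.{u} R) {J : Type u} (Q : J → Type u)
    [∀ y, AddCommGroup (Q y)] [∀ y, Module S (Q y)] (hQ : ∀ y, IsFlat S (Q y))
    (a : ∀ y, A →ₗ[R] BalancedTensor R S C (Q y))
    (h : ∀ (P : ModuleCat.{u} S) (f : A →ₗ[R] BalancedTensor R S C P), IsFlat S P →
      ∃ (y : J) (j : Q y →ₗ[S] P), lTensor R C j ∘ₗ a y = f) :
    ∃ (X : ModuleCat.{u} R) (f : A ⟶ X), IsPreenvelope (cFlat R S C ⊓ pureInjective R) f := by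
  let e := LinearEquiv.ofBijective (tensorPi R S C Q)
    ⟨tensorPi_injective R S C Q, tensorPi_surjective R S C Q⟩
  let b : A →ₗ[R] BalancedTensor R S C (∀ y, Q y) := e.symm.toLinearMap ∘ₗ LinearMap.pi a
  have hb (y : J) : lTensor R C (LinearMap.proj y) ∘ₗ b = a y :=
    LinearMap.ext fun x => congrFun (e.apply_symm_apply (LinearMap.pi a x)) y
  have hPP := hS.isFlat_doubleDual (hS.isFlat_pi hQ)
  refine ⟨_, ModuleCat.ofHom (lTensor R C (doubleDualEval S (∀ y, Q y)) ∘ₗ b),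
    ⟨cFlat_tensor hPP, pureInjective_tensor_doubleDual⟩, ?_⟩
  rintro D ⟨⟨P, hP, ⟨e'⟩⟩, hD⟩ f
  obtain ⟨y, j, hj⟩ := h P (e'.toLinearMap ∘ₗ f.hom) hP
  let k : BalancedTensor R S C (∀ y, Q y) →ₗ[R] D :=
    e'.symm.toLinearMap ∘ₗ lTensor R C j ∘ₗ lTensor R C (LinearMap.proj y)
  obtain ⟨g, hg⟩ := hD _ (isPureShortExact_tensor_doubleDualEval hPP) (ModuleCat.ofHom k)
  refine ⟨g, ModuleCat.hom_ext ?_⟩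
  calc g.hom ∘ₗ lTensor R C (doubleDualEval S _) ∘ₗ b
      = k ∘ₗ b := congrArg (· ∘ₗ b) (congrArg ModuleCat.Hom.hom hg)
    _ = e'.symm.toLinearMap ∘ₗ lTensor R C j ∘ₗ a y := by rw [← hb]; rfl
    _ = f.hom := by rw [hj, ← LinearMap.comp_assoc]; simp

theorem isPreenveloping_cFlat_inf_pureInjective [Module.FinitePresentation Sᵐᵒᵖ C]
    (hS : IsRightCoherent S) : IsPreenveloping (cFlat R S C ⊓ pureInjective R) := by
  intro A
  let W := ClosureGenerator (A × ℕ) (C × S) →₀ S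
  refine hS.exists_isPreenvelope_of_family A
    (J := {y : Σ K : Submodule S W, A →ₗ[R] BalancedTensor R S C (W ⧸ K) // IsFlat S (W ⧸ y.1)})
    (fun y => W ⧸ y.1.1) (fun y => y.2) (fun y => y.1.2) fun P f hP => ?_
  obtain ⟨K, hK, f₀, j, hj⟩ := hP.exists_small_factor f
  exact ⟨⟨⟨K, f₀⟩, hK⟩, j, hj⟩

theorem cFlat_inf_cCotorsion [Module.FinitePresentation Sᵐᵒᵖ C] (hS : IsRightCoherent S)
    (hC : ExtOrthogonal (cFlat R S C) (cFlat R S C ⊓ pureInjective R)) :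
    cFlat R S C ⊓ cCotorsion R S C = cFlat R S C ⊓ pureInjective R := by
  apply le_antisymm
  · rintro D ⟨hD, hDC⟩
    obtain ⟨E, D', f, g, w, hE, ⟨_, hEI⟩, hD'⟩ := (isCogeneratorFor_cFlat hS).2 D hD
    obtain ⟨r, hr⟩ := exists_comp_eq_of_subsingleton_ext hE (hDC D' hD' 1 le_rfl) (𝟙 D)
    exact ⟨hD, pureInjective_of_retract hEI f r hr⟩
  · exact fun D hD => ⟨hD.1, fun X hX => hC X D hX hD⟩

end Preenvelope

end Semidualizing

theorem proposition4p4_general {R S C : Type u} [Ring R] [Ring S] [AddCommGroup C] [Module R C]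
    [Module Sᵐᵒᵖ C] [SMulCommClass R Sᵐᵒᵖ C] [Module.FinitePresentation Sᵐᵒᵖ C]
    (hS : Semidualizing.IsRightCoherent S)
    (hC : Semidualizing.HasFiniteProjectiveResolution R C)
    (hext : ∀ i, 1 ≤ i → Subsingleton (Ext (ModuleCat.of R C) (ModuleCat.of R C) i)) :
    (Semidualizing.cFlat R S C ⊓ Semidualizing.cCotorsion R S C =
      Semidualizing.cFlat R S C ⊓ Semidualizing.pureInjective R) ∧
    Semidualizing.IsInjectiveCogeneratorFor
      (Semidualizing.cFlat R S C ⊓ Semidualizing.pureInjective R) (Semidualizing.cFlat R S C) ∧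
    Semidualizing.IsPreenveloping (Semidualizing.cFlat R S C ⊓ Semidualizing.pureInjective R) :=
  have hperp := Semidualizing.extOrthogonal_cFlat (S := S) hC hext
  ⟨Semidualizing.cFlat_inf_cCotorsion hS hperp,
    ⟨Semidualizing.isCogeneratorFor_cFlat hS, hperp⟩,
    Semidualizing.isPreenveloping_cFlat_inf_pureInjective hS⟩

theorem proposition4p4 (R S C : Type u) [Ring R] [Ring S] [AddCommGroup C] [Module R C]
    [Module Sᵐᵒᵖ C] [SMulCommClass R Sᵐᵒᵖ C]
    (hS : Semidualizing.IsRightCoherent S) (hC : Semidualizing.IsSemidualizing R S C) :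
    (Semidualizing.cFlat R S C ⊓ Semidualizing.cCotorsion R S C =
      Semidualizing.cFlat R S C ⊓ Semidualizing.pureInjective R) ∧
    Semidualizing.IsInjectiveCogeneratorFor
      (Semidualizing.cFlat R S C ⊓ Semidualizing.pureInjective R) (Semidualizing.cFlat R S C) ∧
    (Semidualizing.IsFaithfullySemidualizing R S C →
      Semidualizing.IsPreenveloping
        (Semidualizing.cFlat R S C ⊓ Semidualizing.pureInjective R)) := by
  have := hC.finite_right.finitePresentation
  obtain ⟨hperp, hcog, hpre⟩ := proposition4p4_general (S := S) hS hC.finite_left hC.ext_left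
  exact ⟨hperp, hcog, fun _ => hpre⟩
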